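/- Let $n,l\in\mathbb N$ and let $D_i=\mathrm{diag}(\mu_{i,1},\dots,\mu_{i,n})$, $1\le i\le l$, be invertible complex diagonal matrices. Let $F=\{F_i\}_{1\le i\le l}$ be a family of pairwise commuting germs of holomorphic diffeomorphisms of $(\mathbb C^n,0)$ (so $F_i(0)=0$) such that the linear part of $F_i$ at the origin is $D_i$. For $Q=(q_1,\dots,q_n)\in\mathbb N^n$ put $|Q|=q_1+\cdots+q_n$ and $\mu_i^Q=\mu_{i,1}^{q_1}\cdots\mu_{i,n}^{q_n}$, and for $k\ge 1$ let $$\omega_k(D)=\inf\Bigl\{\max_{1\le i\le l}|\mu_i^Q-\mu_{i,j}|\ \Big|\ Q\in\mathbb N^n,\ 2\le|Q|\le 2^k,\ 1\le j\le n,\ \max_{1\le i\le l}|\mu_i^Q-\mu_{i,j}|\ne 0\Bigr\}.$$ Assume that the family $D=\{D_i\}$ is diophantine, that is, $$-\sum_{k\ge1}\frac{\ln\omega_k(D)}{2^k}<+\infty$$ (the condition is void if $\max_i|\mu_i^Q-\mu_{i,j}|=0$ for all $|Q|\ge 2$ and all $j$). Assume moreover that $F$ is formally linearizable: there is a formal diffeomorphism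 $\hat\Phi$ of $(\mathbb C^n,0)$, tangent to the identity at the origin, such that $\hat\Phi\circ\hat F_i\circ\hat\Phi^{-1}=D_i$ for all $1\le i\le l$, where $\hat F_i$ is the Taylor expansion of $F_i$ at the origin. Then $F$ is holomorphically linearizable in $(\mathbb C^n,0)$: there is a germ $\Phi$ of holomorphic diffeomorphism of $(\mathbb C^n,0)$, tangent to the identity at the origin, such that $\Phi\circ F_i\circ\Phi^{-1}=D_i$ as germs at the origin for all $1\le i\le l$. -/

import Mathlib

open Filter Topology

namespace GermLin

/-- The diagonal linear map `x ↦ diag(μ₁,…,μₙ) x` of `ℂⁿ`. -/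
noncomputable def diagMap {n : ℕ} (μ : Fin n → ℂ) : (Fin n → ℂ) →L[ℂ] (Fin n → ℂ) :=
  ContinuousLinearMap.pi fun j => μ j • ContinuousLinearMap.proj j

/-! ### Germs at the origin, given by representatives -/

/-- `f` and `g` represent germs of holomorphic maps `(ℂⁿ,0) → (ℂⁿ,0)` that are inverse to
each other. -/
structure AreInverseGerms {n : ℕ} (f g : (Fin n → ℂ) → (Fin n → ℂ)) : Prop where
  analytic_left : AnalyticAt ℂ f 0
  analytic_right : AnalyticAt ℂ g 0
  map_zero_left : f 0 = 0
  map_zero_right : g 0 = 0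
  comp_eq_left : f ∘ g =ᶠ[𝓝 0] id
  comp_eq_right : g ∘ f =ᶠ[𝓝 0] id

/-- `f` represents a germ of holomorphic diffeomorphism of `(ℂⁿ,0)`. -/
def IsGermDiffeo {n : ℕ} (f : (Fin n → ℂ) → (Fin n → ℂ)) : Prop :=
  ∃ g, AreInverseGerms f g

/-- `F` is a family of pairwise commuting germs of holomorphic diffeomorphisms of `(ℂⁿ,0)`
such that the linear part of `F i` at the origin is `diag(μ i 1, …, μ i n)`. -/
structure IsAbelianFamily {n l : ℕ} (μ : Fin l → Fin n → ℂ)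
    (F : Fin l → (Fin n → ℂ) → (Fin n → ℂ)) : Prop where
  diffeo : ∀ i, IsGermDiffeo (F i)
  linear_part : ∀ i, HasFDerivAt (F i) (diagMap (μ i)) 0
  commute : ∀ i j, F i ∘ F j =ᶠ[𝓝 0] F j ∘ F i

/-- There is a germ of holomorphic diffeomorphism `Φ` of `(ℂⁿ,0)`, tangent to the identity, with
`Φ ∘ F i ∘ Φ⁻¹ = D i` as germs at the origin, for all `i`. -/
def HolomorphicallyLinearizable {n l : ℕ} (μ : Fin l → Fin n → ℂ)
    (F : Fin l → (Fin n → ℂ) → (Fin n → ℂ)) : Prop :=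
  ∃ Φ Ψ : (Fin n → ℂ) → (Fin n → ℂ), AreInverseGerms Φ Ψ ∧
    HasFDerivAt Φ (ContinuousLinearMap.id ℂ (Fin n → ℂ)) 0 ∧
    ∀ i, Φ ∘ F i ∘ Ψ =ᶠ[𝓝 0] diagMap (μ i)

/-! ### Formal maps -/

/-- An `n`-tuple of formal power series in `n` variables. -/
abbrev FormalMap (n : ℕ) : Type := Fin n → MvPowerSeries (Fin n) ℂ

/-- Composition `f ∘ g`, meaningful when `g` has no constant term. -/
noncomputable def FormalMap.comp {n : ℕ} (f g : FormalMap n) : FormalMap n :=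
  fun j => MvPowerSeries.subst g (f j)

/-- The formal identity map. -/
noncomputable def FormalMap.ident (n : ℕ) : FormalMap n := fun j => MvPowerSeries.X j

/-- The formal map `x ↦ diag(μ₁,…,μₙ) x`. -/
noncomputable def FormalMap.diag {n : ℕ} (μ : Fin n → ℂ) : FormalMap n :=
  fun j => μ j • MvPowerSeries.X j

/-- `f` and `g` are formal diffeomorphisms of `(ℂⁿ,0)`, inverse to each other. -/
structure FormalMap.AreInverse {n : ℕ} (f g : FormalMap n) : Prop where
  constantCoeff_left : ∀ j, MvPowerSeries.constantCoeff (f j) = 0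
  constantCoeff_right : ∀ j, MvPowerSeries.constantCoeff (g j) = 0
  comp_eq_left : f.comp g = FormalMap.ident n
  comp_eq_right : g.comp f = FormalMap.ident n

/-- The formal map `f` has linear part the identity. -/
def FormalMap.TangentToId {n : ℕ} (f : FormalMap n) : Prop :=
  ∀ j k, MvPowerSeries.coeff (Finsupp.single k 1) (f j) = if j = k then 1 else 0

/-- `fhat` is the Taylor expansion of `f` at the origin:
`f_j(x) = ∑_Q fhat_{j,Q} x^Q` for all `x` near `0`. -/
def IsTaylorExpansion {n : ℕ} (fhat : FormalMap n) (f : (Fin n → ℂ) → (Fin n → ℂ)) : Prop :=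
  ∀ᶠ x in 𝓝 (0 : Fin n → ℂ), ∀ j,
    HasSum (fun Q : Fin n →₀ ℕ => MvPowerSeries.coeff Q (fhat j) * ∏ k, x k ^ Q k) (f x j)

/-- There is a formal diffeomorphism `Φ` of `(ℂⁿ,0)`, tangent to the identity, with
`Φ ∘ F i ∘ Φ⁻¹ = D i` as formal power series, for all `i`. -/
def FormallyLinearizable {n l : ℕ} (μ : Fin l → Fin n → ℂ)
    (F : Fin l → (Fin n → ℂ) → (Fin n → ℂ)) : Prop :=
  ∃ Fhat : Fin l → FormalMap n, (∀ i, IsTaylorExpansion (Fhat i) (F i)) ∧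
    ∃ Φ Ψ : FormalMap n, FormalMap.AreInverse Φ Ψ ∧ Φ.TangentToId ∧
      ∀ i, Φ.comp ((Fhat i).comp Ψ) = FormalMap.diag (μ i)

/-! ### The small divisor condition -/

/-- `max_i |μ_i^Q - μ_{i,j}|` (the norm on `Fin l → ℂ` is the maximum norm). -/
noncomputable def smallDivisor {n l : ℕ} (μ : Fin l → Fin n → ℂ) (Q : Fin n →₀ ℕ) (j : Fin n) :
    ℝ :=
  ‖(fun i => (∏ k, μ i k ^ Q k) - μ i j : Fin l → ℂ)‖

/-- `ω_k(D)`: the infimum of the nonzero numbers `max_i |μ_i^Q - μ_{i,j}|`, `2 ≤ |Q| ≤ 2^k`. -/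
noncomputable def omega {n l : ℕ} (μ : Fin l → Fin n → ℂ) (k : ℕ) : ℝ :=
  sInf {r : ℝ | r ≠ 0 ∧ ∃ (Q : Fin n →₀ ℕ) (j : Fin n),
    2 ≤ Q.degree ∧ Q.degree ≤ 2 ^ k ∧ r = smallDivisor μ Q j}

/-- `-∑_{k ≥ 1} ln ω_k(D) / 2^k < +∞`. As `ω_k(D)` is non-increasing in `k`, the terms are bounded
below by a summable sequence, and finiteness of the sum is summability. If no `k` has a
nonzero divisor (`D` consists of identity matrices, or `n = 0`, or `l = 0`), the condition is
void: then `omega μ k = sInf ∅ = 0` and all terms vanish. -/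
def IsDiophantine {n l : ℕ} (μ : Fin l → Fin n → ℂ) : Prop :=
  Summable fun k : ℕ => -Real.log (omega μ (k + 1)) / 2 ^ (k + 1)

end GermLin

/-!
# Holomorphic linearization of formally linearizable commuting germs

The conjugacy equation is solved by a Newton scheme, carried out on formal power series with the
weighted `ℓ¹` norms `‖f‖_r = ∑_Q |f_Q| r^|Q|` (`wnorm`). These norms are submultiplicative, and
composition satisfies `‖f ∘ a‖_r ≤ ‖f‖_s` whenever `‖a_j‖_r ≤ s` (`wnorm_comp_le`), so that every
estimate of the scheme is an inequality between norms.

Write `F_i = D_i ∘ G_i`, and suppose that `G_i = id + g_i` with `g_i` of order `> m` and that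
`id + ψ`, with `ψ` of order `> m`, linearizes all the `F_i` formally. In degrees `≤ 2m` the conjugacy
equation then reduces to the linear equation `D_i g_i = ψ ∘ D_i - D_i ψ` (`linearized_equation`).
It holds for all `i` at once, so a coefficient of `ψ` can be computed from the `i` with the largest
divisor `|μ_i^Q - μ_{i,j}|`; unless all these divisors vanish, it is bounded by `g` times
`1 / ω_{k+1}`, if `m = 2^k` (`norm_coeff_nonresPart_le`). The terms of `ψ` for which all the divisors
vanish commute with every `D_i` and can be removed from the formal linearization. Conjugating by
`H = id + h`, with `h` the remaining terms of `ψ` in degrees `≤ 2m`, replaces `m` by `2m`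
(`PartialLinearization.step`).

The small divisor occurs only once in each step, and it is absorbed by shrinking the radius: as `h`
has order `> m = 2^k`, reducing the radius by a factor `t` gains `t^m`, so that `t ~ ω_{k+1}^(1/2^k)`
is enough. The product of these factors is positive exactly because `-∑ ln ω_k / 2^k` is finite
(`exists_radii`). Expanding eigenvalues cost no domain, since only `D_i⁻¹ ∘ H ∘ D_i` enters, and the
linear equation bounds it by `h` and `g_i` (`enorm_coeff_conj_diag_sub_le`).

The limit `Θ` has finite norm on a polydisc and satisfies `F_i ∘ Θ = Θ ∘ D_i` formally
(`exists_bounded_linearization`). Its sum is analytic, the formal identity becomes an identity of germs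
(`evalSeries_comp`), and the local inverse of the sum is the linearizing diffeomorphism
(`exists_germ_inverse`).
-/

namespace GermLin

open MvPowerSeries
open scoped ENNReal NNReal

/-! ### Composition of formal maps and congruences of jets -/

namespace FormalMap

variable {n : ℕ}

/-- The formal map `f` sends the origin to the origin. -/
def NoConst (f : FormalMap n) : Prop := ∀ j, constantCoeff (f j) = 0

/-- The formal maps `f` and `g` have the same coefficients in all degrees `< d`. -/
def EqBelow (d : ℕ) (f g : FormalMap n) : Prop :=
  ∀ j (Q : Fin n →₀ ℕ), Q.degree < d → coeff Q (f j) = coeff Q (g j)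

theorem NoConst.hasSubst {f : FormalMap n} (hf : f.NoConst) : HasSubst f :=
  hasSubst_of_constantCoeff_zero hf

theorem noConst_iff {f : FormalMap n} : f.NoConst ↔ EqBelow 1 f 0 := by
  constructor
  · intro h j Q hQ
    have : Q = 0 := by
      rw [← Finsupp.degree_eq_zero_iff]; omega
    subst this
    simpa using h j
  · intro h j
    simpa using h j 0 (by simp)

theorem noConst_ident : (ident n).NoConst := fun j => by simp [ident]

theorem noConst_diag (μ : Fin n → ℂ) : (diag μ).NoConst := fun j => by simp [diag]

theorem EqBelow.refl (d : ℕ) (f : FormalMap n) : EqBelow d f f := fun _ _ _ => rfl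

theorem EqBelow.symm {d : ℕ} {f g : FormalMap n} (h : EqBelow d f g) : EqBelow d g f :=
  fun j Q hQ => (h j Q hQ).symm

theorem EqBelow.trans {d : ℕ} {f g k : FormalMap n} (h : EqBelow d f g) (h' : EqBelow d g k) :
    EqBelow d f k := fun j Q hQ => (h j Q hQ).trans (h' j Q hQ)

theorem EqBelow.mono {d e : ℕ} {f g : FormalMap n} (h : EqBelow d f g) (hde : e ≤ d) :
    EqBelow e f g := fun j Q hQ => h j Q (hQ.trans_le hde)

theorem EqBelow.add {d : ℕ} {f g f' g' : FormalMap n} (h : EqBelow d f g)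
    (h' : EqBelow d f' g') : EqBelow d (f + f') (g + g') := fun j Q hQ => by
  simp [h j Q hQ, h' j Q hQ]

theorem EqBelow.sub {d : ℕ} {f g f' g' : FormalMap n} (h : EqBelow d f g)
    (h' : EqBelow d f' g') : EqBelow d (f - f') (g - g') := fun j Q hQ => by
  simp [h j Q hQ, h' j Q hQ]

theorem eq_of_eqBelow {f g : FormalMap n} (h : ∀ d, EqBelow d f g) : f = g := by
  funext j
  ext Q
  exact h (Q.degree + 1) j Q (by omega)

theorem EqBelow.noConst {d : ℕ} {f g : FormalMap n} (h : EqBelow (d + 1) f g)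
    (hg : g.NoConst) : f.NoConst :=
  noConst_iff.2 ((h.mono (by omega)).trans (noConst_iff.1 hg))

theorem NoConst.add {f g : FormalMap n} (hf : f.NoConst) (hg : g.NoConst) : (f + g).NoConst :=
  fun j => by simp [hf j, hg j]

theorem NoConst.sub {f g : FormalMap n} (hf : f.NoConst) (hg : g.NoConst) : (f - g).NoConst :=
  fun j => by simp [hf j, hg j]

/-- A sequence of formal maps whose jets stabilise has a formal limit. -/
theorem exists_limit {X : ℕ → FormalMap n} (hX : ∀ m, EqBelow (m + 1) (X (m + 1)) (X m)) :
    ∃ Y : FormalMap n, ∀ m, EqBelow (m + 1) Y (X m) := by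
  have key : ∀ m k, EqBelow (m + 1) (X (m + k)) (X m) := by
    intro m k
    induction k with
    | zero => exact EqBelow.refl _ _
    | succ k ih => exact ((hX (m + k)).mono (by omega)).trans ih
  refine ⟨fun j Q => coeff Q (X Q.degree j), fun m j Q hQ => ?_⟩
  obtain ⟨k, rfl⟩ := Nat.exists_eq_add_of_le (Nat.lt_succ_iff.1 hQ)
  exact (key Q.degree k j Q (by omega)).symm

/-! ### Algebraic rules for composition -/

theorem NoConst.comp {f g : FormalMap n} (hf : f.NoConst) (hg : g.NoConst) :
    (f.comp g).NoConst := fun j => constantCoeff_subst_eq_zero hg.hasSubst hg (hf j)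

theorem comp_assoc (f : FormalMap n) {g k : FormalMap n} (hg : g.NoConst) (hk : k.NoConst) :
    (f.comp g).comp k = f.comp (g.comp k) := by
  funext j
  exact subst_comp_subst_apply hg.hasSubst hk.hasSubst (f j)

theorem comp_ident (f : FormalMap n) : f.comp (ident n) = f := by
  funext j
  exact congr_fun subst_self (f j)

theorem ident_comp {g : FormalMap n} (hg : g.NoConst) : (ident n).comp g = g := by
  funext j
  exact subst_X hg.hasSubst j

theorem sub_comp (f g : FormalMap n) {k : FormalMap n} (hk : k.NoConst) :
    (f - g).comp k = f.comp k - g.comp k := by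
  funext j
  exact subst_sub hk.hasSubst (f j) (g j)

theorem diag_comp (μ : Fin n → ℂ) {g : FormalMap n} (hg : g.NoConst) (j : Fin n) :
    (diag μ).comp g j = μ j • g j := by
  simp only [comp, diag]
  rw [subst_smul hg.hasSubst, subst_X hg.hasSubst]

theorem coeff_diag_comp (μ : Fin n → ℂ) {g : FormalMap n} (hg : g.NoConst) (j : Fin n)
    (Q : Fin n →₀ ℕ) : coeff Q ((diag μ).comp g j) = μ j * coeff Q (g j) := by
  rw [diag_comp μ hg]; simp

theorem coeff_comp_diag (μ : Fin n → ℂ) (f : FormalMap n) (j : Fin n)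
    (Q : Fin n →₀ ℕ) : coeff Q (f.comp (diag μ) j) = (∏ k, μ k ^ Q k) * coeff Q (f j) := by
  have : f.comp (diag μ) j = rescale μ (f j) := by
    rw [rescale_eq_subst]; rfl
  rw [this, coeff_rescale, Finsupp.prod_fintype _ _ (by simp)]

theorem diag_comp_diag_inv {μ : Fin n → ℂ} (hμ : ∀ j, μ j ≠ 0) :
    (diag μ).comp (diag μ⁻¹) = ident n := by
  funext j
  rw [diag_comp _ (noConst_diag _)]
  simp [diag, ident, smul_smul, hμ j]

theorem diag_inv_comp_diag {μ : Fin n → ℂ} (hμ : ∀ j, μ j ≠ 0) :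
    (diag μ⁻¹).comp (diag μ) = ident n := by
  funext j
  rw [diag_comp _ (noConst_diag _)]
  simp [diag, ident, smul_smul, hμ j]

/-! ### Congruences under composition -/

/-- If `a` and `b` agree in degrees `≤ e`, then `a^Q - b^Q` has order at least `e + |Q|`. -/
theorem le_order_monomial_sub {e : ℕ} {a b : FormalMap n} (ha : a.NoConst) (hb : b.NoConst)
    (hab : EqBelow (e + 1) a b) (Q : Fin n →₀ ℕ) :
    (Q.degree : ℕ∞) ≤ (Q.prod fun s m => a s ^ m).order ∧
    (Q.degree : ℕ∞) ≤ (Q.prod fun s m => b s ^ m).order ∧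
    ((e + Q.degree : ℕ) : ℕ∞) ≤
      ((Q.prod fun s m => a s ^ m) - (Q.prod fun s m => b s ^ m)).order := by
  -- both the powers of one variable and the monomials are treated by the telescoping identity
  have mul_case : ∀ (f f' g g' : MvPowerSeries (Fin n) ℂ) (p q : ℕ),
      ((p : ℕ∞) ≤ f.order ∧ (p : ℕ∞) ≤ f'.order ∧ ((e + p : ℕ) : ℕ∞) ≤ (f - f').order) →
      ((q : ℕ∞) ≤ g.order ∧ (q : ℕ∞) ≤ g'.order ∧ ((e + q : ℕ) : ℕ∞) ≤ (g - g').order) →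
      (((p + q : ℕ) : ℕ∞) ≤ (f * g).order ∧ ((p + q : ℕ) : ℕ∞) ≤ (f' * g').order ∧
        ((e + (p + q) : ℕ) : ℕ∞) ≤ (f * g - f' * g').order) := by
    rintro f f' g g' p q ⟨h1, h2, h3⟩ ⟨k1, k2, k3⟩
    refine ⟨?_, ?_, ?_⟩
    · push_cast; exact (add_le_add h1 k1).trans le_order_mul
    · push_cast; exact (add_le_add h2 k2).trans le_order_mul
    · have : f * g - f' * g' = (f - f') * g + f' * (g - g') := by ring
      rw [this]
      refine le_trans (le_min ?_ ?_) min_order_le_add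
      · refine le_trans ?_ le_order_mul
        refine le_trans (le_of_eq ?_) (add_le_add h3 k1)
        push_cast; ring
      · refine le_trans ?_ le_order_mul
        refine le_trans (le_of_eq ?_) (add_le_add h2 k3)
        push_cast; ring
  have pow_case : ∀ (s : Fin n) (m : ℕ), ((m : ℕ∞) ≤ (a s ^ m).order ∧
      (m : ℕ∞) ≤ (b s ^ m).order ∧ ((e + m : ℕ) : ℕ∞) ≤ (a s ^ m - b s ^ m).order) := by
    intro s m
    induction m with
    | zero => simp
    | succ m ih =>
      rw [pow_succ, pow_succ]
      refine mul_case _ _ _ _ m 1 ih ⟨?_, ?_, ?_⟩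
      · exact_mod_cast one_le_order_iff_constCoeff_eq_zero.2 (ha s)
      · exact_mod_cast one_le_order_iff_constCoeff_eq_zero.2 (hb s)
      · refine nat_le_order fun P hP => ?_
        simp [hab s P hP]
  induction Q using Finsupp.induction_linear with
  | zero => simp
  | add P Q hP hQ =>
    rw [Finsupp.prod_add_index' (by simp) (by simp [pow_add]),
      Finsupp.prod_add_index' (by simp) (by simp [pow_add]), map_add]
    exact mul_case _ _ _ _ _ _ hP hQ
  | single s m =>
    simp only [Finsupp.degree_single, Finsupp.prod_single_index, pow_zero]
    exact pow_case s m

/-- If `f` has order at least `p` and `a`, `b` agree in degrees `≤ e`, then `f ∘ a` and `f ∘ b`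
agree in degrees `< e + p`. -/
theorem EqBelow.comp_right {e p : ℕ} {f a b : FormalMap n} (hab : EqBelow (e + 1) a b)
    (ha : a.NoConst) (hb : b.NoConst) (hf : EqBelow p f 0) :
    EqBelow (e + p) (f.comp a) (f.comp b) := by
  intro j P hP
  simp only [comp]
  rw [coeff_subst ha.hasSubst, coeff_subst hb.hasSubst]
  refine finsum_congr fun Q => ?_
  by_cases hQ : Q.degree < p
  · have : coeff Q (f j) = 0 := by simpa using hf j Q hQ
    simp [this]
  · have h := (le_order_monomial_sub ha hb hab Q).2.2
    have : coeff P ((Q.prod fun s m => a s ^ m) - (Q.prod fun s m => b s ^ m)) = 0 := by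
      refine coeff_of_lt_order (lt_of_lt_of_le ?_ h)
      exact_mod_cast (by omega : P.degree < e + Q.degree)
    rw [map_sub, sub_eq_zero] at this
    rw [this]

theorem EqBelow.comp_left {d : ℕ} {f g a : FormalMap n} (hfg : EqBelow d f g)
    (ha : a.NoConst) : EqBelow d (f.comp a) (g.comp a) := by
  intro j P hP
  simp only [comp]
  rw [coeff_subst ha.hasSubst, coeff_subst ha.hasSubst]
  refine finsum_congr fun Q => ?_
  by_cases hQ : Q.degree < d
  · rw [hfg j Q hQ]
  · have h := (le_order_monomial_sub (e := 0) ha ha (EqBelow.refl _ _) Q).1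
    have : coeff P (Q.prod fun s m => a s ^ m) = 0 := by
      refine coeff_of_lt_order (lt_of_lt_of_le ?_ h)
      exact_mod_cast (by omega : P.degree < Q.degree)
    rw [this, smul_zero, smul_zero]

theorem EqBelow.comp {d : ℕ} {f g a b : FormalMap n} (hfg : EqBelow (d + 1) f g)
    (hab : EqBelow (d + 1) a b) (hg : g.NoConst) (ha : a.NoConst) (hb : b.NoConst) :
    EqBelow (d + 1) (f.comp a) (g.comp b) :=
  (hfg.comp_left ha).trans (hab.comp_right ha hb (noConst_iff.1 hg))

/-- A formal map tangent to the identity is injective under left composition, jet by jet. -/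
theorem EqBelow.of_comp {d : ℕ} {K X Y : FormalMap n} (hK : EqBelow 2 K (ident n))
    (hX : X.NoConst) (hY : Y.NoConst) (h : EqBelow d (K.comp X) (K.comp Y)) : EqBelow d X Y := by
  have hk : EqBelow 2 (K - ident n) 0 := by
    simpa using hK.sub (EqBelow.refl 2 (ident n))
  have hKX : ∀ Z : FormalMap n, Z.NoConst → K.comp Z = Z + (K - ident n).comp Z := by
    intro Z hZ
    rw [sub_comp _ _ hZ, ident_comp hZ]; abel
  rw [hKX X hX, hKX Y hY] at h
  have : ∀ e ≤ d, EqBelow e X Y := by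
    intro e
    induction e with
    | zero => intro _ j Q hQ; omega
    | succ e ih =>
      intro he
      rcases Nat.eq_zero_or_pos e with rfl | he0
      · exact (noConst_iff.1 hX).trans (noConst_iff.1 hY).symm
      · obtain ⟨e, rfl⟩ := Nat.exists_eq_succ_of_ne_zero he0.ne'
        have h1 := (ih (by omega)).comp_right hX hY hk
        have h2 := (h.mono he).sub (h1.mono (by omega))
        simpa using h2
  exact this d le_rfl

theorem comp_left_cancel {K X Y : FormalMap n} (hK : EqBelow 2 K (ident n))
    (hX : X.NoConst) (hY : Y.NoConst) (h : K.comp X = K.comp Y) : X = Y :=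
  eq_of_eqBelow fun _ => EqBelow.of_comp hK hX hY (by rw [h]; exact EqBelow.refl _ _)

end FormalMap

/-! ### The weighted `ℓ¹` norms -/

variable {n : ℕ}

/-- The weighted `ℓ¹` norm `∑_Q |f_Q| r^|Q|` of a formal power series, possibly infinite. -/
noncomputable def wnorm (r : ℝ≥0∞) (f : MvPowerSeries (Fin n) ℂ) : ℝ≥0∞ :=
  ∑' Q : Fin n →₀ ℕ, ‖coeff Q f‖ₑ * r ^ Q.degree

theorem wnorm_mono {r s : ℝ≥0∞} (h : r ≤ s) (f : MvPowerSeries (Fin n) ℂ) :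
    wnorm r f ≤ wnorm s f :=
  ENNReal.tsum_le_tsum fun Q => by gcongr

theorem wnorm_add_le (r : ℝ≥0∞) (f g : MvPowerSeries (Fin n) ℂ) :
    wnorm r (f + g) ≤ wnorm r f + wnorm r g := by
  unfold wnorm
  rw [← ENNReal.tsum_add]
  refine ENNReal.tsum_le_tsum fun Q => ?_
  rw [← add_mul, map_add]
  gcongr
  exact enorm_add_le _ _

theorem wnorm_neg (r : ℝ≥0∞) (f : MvPowerSeries (Fin n) ℂ) : wnorm r (-f) = wnorm r f := by
  simp [wnorm]

theorem wnorm_sub_le (r : ℝ≥0∞) (f g : MvPowerSeries (Fin n) ℂ) :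
    wnorm r (f - g) ≤ wnorm r f + wnorm r g := by
  rw [sub_eq_add_neg, ← wnorm_neg r g]
  exact wnorm_add_le _ _ _

theorem wnorm_smul (r : ℝ≥0∞) (c : ℂ) (f : MvPowerSeries (Fin n) ℂ) :
    wnorm r (c • f) = ‖c‖ₑ * wnorm r f := by
  simp [wnorm, ← ENNReal.tsum_mul_left, enorm_mul, mul_assoc]

theorem wnorm_zero (r : ℝ≥0∞) : wnorm r (0 : MvPowerSeries (Fin n) ℂ) = 0 := by
  simp [wnorm]

theorem wnorm_X (r : ℝ≥0∞) (j : Fin n) : wnorm r (X j : MvPowerSeries (Fin n) ℂ) = r := by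
  classical
  unfold wnorm
  rw [tsum_eq_single (Finsupp.single j 1)]
  · simp [coeff_X]
  · intro Q hQ
    simp [coeff_X, hQ]

theorem wnorm_one (r : ℝ≥0∞) : wnorm r (1 : MvPowerSeries (Fin n) ℂ) = 1 := by
  classical
  unfold wnorm
  rw [tsum_eq_single 0]
  · simp
  · intro Q hQ
    simp [coeff_one, hQ]

theorem wnorm_mul_le (r : ℝ≥0∞) (f g : MvPowerSeries (Fin n) ℂ) :
    wnorm r (f * g) ≤ wnorm r f * wnorm r g := by
  classical
  calc wnorm r (f * g)
      ≤ ∑' Q : Fin n →₀ ℕ, ∑ p ∈ Finset.HasAntidiagonal.antidiagonal Q,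
          (‖coeff p.1 f‖ₑ * r ^ p.1.degree) * (‖coeff p.2 g‖ₑ * r ^ p.2.degree) := by
        refine ENNReal.tsum_le_tsum fun Q => ?_
        rw [coeff_mul]
        refine (mul_le_mul_left (enorm_sum_le _ _) _).trans ?_
        rw [Finset.sum_mul]
        refine Finset.sum_le_sum fun p hp => ?_
        rw [← Finset.HasAntidiagonal.mem_antidiagonal.1 hp, map_add, pow_add, enorm_mul]
        exact le_of_eq (by ring)
    _ = ∑' p : (Fin n →₀ ℕ) × (Fin n →₀ ℕ),
          (‖coeff p.1 f‖ₑ * r ^ p.1.degree) * (‖coeff p.2 g‖ₑ * r ^ p.2.degree) := by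
        rw [← Finset.HasAntidiagonal.sigmaAntidiagonalEquivProd.tsum_eq, ENNReal.tsum_sigma']
        refine tsum_congr fun Q => ?_
        rw [tsum_fintype, ← Finset.sum_coe_sort]
        rfl
    _ = wnorm r f * wnorm r g := by
        rw [ENNReal.tsum_prod (f := fun P Q => (‖coeff P f‖ₑ * r ^ P.degree) *
          (‖coeff Q g‖ₑ * r ^ Q.degree))]
        simp [wnorm, ENNReal.tsum_mul_left, ENNReal.tsum_mul_right]

theorem wnorm_pow_le {r s : ℝ≥0∞} {f : MvPowerSeries (Fin n) ℂ} (h : wnorm r f ≤ s) (m : ℕ) :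
    wnorm r (f ^ m) ≤ s ^ m := by
  induction m with
  | zero => simp [wnorm_one]
  | succ m ih =>
    rw [pow_succ, pow_succ]
    exact (wnorm_mul_le _ _ _).trans (mul_le_mul' ih h)

theorem wnorm_monomial_le {r s : ℝ≥0∞} {a : FormalMap n} (h : ∀ j, wnorm r (a j) ≤ s)
    (Q : Fin n →₀ ℕ) : wnorm r (Q.prod fun j m => a j ^ m) ≤ s ^ Q.degree := by
  induction Q using Finsupp.induction_linear with
  | zero => simp [wnorm_one]
  | add P Q hP hQ =>
    rw [Finsupp.prod_add_index' (by simp) (by simp [pow_add]), map_add, pow_add]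
    exact (wnorm_mul_le _ _ _).trans (mul_le_mul' hP hQ)
  | single j m =>
    simp only [Finsupp.degree_single, Finsupp.prod_single_index, pow_zero]
    exact wnorm_pow_le (h j) m

theorem enorm_finsum_le {ι : Type*} (u : ι → ℂ) : ‖∑ᶠ i, u i‖ₑ ≤ ∑' i, ‖u i‖ₑ := by
  by_cases hu : u.HasFiniteSupport
  · rw [finsum_eq_sum _ hu]
    exact (enorm_sum_le _ _).trans (ENNReal.sum_le_tsum _)
  · rw [finsum_of_not_hasFiniteSupport hu]; simp

/-- Composition contracts the weighted norms: if `a` maps the polydisc of radius `r` into the one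
of radius `s` in the `ℓ¹` sense, then `‖f ∘ a‖_r ≤ ‖f‖_s`. -/
theorem wnorm_comp_le {r s : ℝ≥0∞} {a : FormalMap n} (ha : a.NoConst)
    (h : ∀ j, wnorm r (a j) ≤ s) (f : FormalMap n) (i : Fin n) :
    wnorm r (f.comp a i) ≤ wnorm s (f i) := by
  calc wnorm r (f.comp a i)
      ≤ ∑' P : Fin n →₀ ℕ, ∑' Q : Fin n →₀ ℕ,
          ‖coeff Q (f i)‖ₑ * (‖coeff P (Q.prod fun j m => a j ^ m)‖ₑ * r ^ P.degree) := by
        refine ENNReal.tsum_le_tsum fun P => ?_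
        simp only [FormalMap.comp]
        rw [coeff_subst ha.hasSubst]
        refine (mul_le_mul_left (enorm_finsum_le _) _).trans ?_
        rw [← ENNReal.tsum_mul_right]
        refine le_of_eq (tsum_congr fun Q => ?_)
        rw [smul_eq_mul, enorm_mul, mul_assoc]
    _ = ∑' Q : Fin n →₀ ℕ,
          ‖coeff Q (f i)‖ₑ * wnorm r (Q.prod fun j m => a j ^ m) := by
        rw [ENNReal.tsum_comm]
        simp only [ENNReal.tsum_mul_left, wnorm]
    _ ≤ wnorm s (f i) := by
        refine ENNReal.tsum_le_tsum fun Q => ?_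
        gcongr
        exact wnorm_monomial_le h Q

/-- Shrinking the radius by a factor `t ≤ 1` gains a factor `t ^ d` on series of order `≥ d`. -/
theorem wnorm_mul_radius_le {d : ℕ} {t r : ℝ≥0∞} (ht : t ≤ 1) {f : MvPowerSeries (Fin n) ℂ}
    (hf : ∀ Q : Fin n →₀ ℕ, Q.degree < d → coeff Q f = 0) :
    wnorm (t * r) f ≤ t ^ d * wnorm r f := by
  unfold wnorm
  rw [← ENNReal.tsum_mul_left]
  refine ENNReal.tsum_le_tsum fun Q => ?_
  by_cases hQ : Q.degree < d
  · simp [hf Q hQ]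
  · rw [mul_pow, mul_left_comm, ← mul_assoc, ← mul_assoc]
    gcongr ?_ * _ * _
    exact pow_le_pow_right_of_le_one' ht (not_lt.1 hQ)

theorem wnorm_le_of_approx {r C : ℝ≥0∞} {f : FormalMap n} {j : Fin n}
    (h : ∀ d, ∃ g : FormalMap n, FormalMap.EqBelow d f g ∧ wnorm r (g j) ≤ C) :
    wnorm r (f j) ≤ C := by
  unfold wnorm
  rw [ENNReal.tsum_eq_iSup_sum]
  refine iSup_le fun S => ?_
  obtain ⟨g, hg, hgC⟩ := h (S.sup Finsupp.degree + 1)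
  refine le_trans (le_of_eq ?_) ((ENNReal.sum_le_tsum S).trans hgC)
  refine Finset.sum_congr rfl fun Q hQ => ?_
  rw [hg j Q (Nat.lt_succ_of_le (Finset.le_sup (f := Finsupp.degree) hQ))]

namespace FormalMap

/-- The equation `K ∘ X = A` for `K` tangent to the identity can be solved formally, and the
solution inherits bounds: if `‖A‖_r + ‖K - id‖_s ≤ s` then `‖X‖_r ≤ s`. -/
theorem exists_comp_eq {K A : FormalMap n} (hK : EqBelow 2 K (ident n)) (hA : A.NoConst) :
    ∃ X : FormalMap n, X.NoConst ∧ K.comp X = A ∧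
      ∀ r s : ℝ≥0∞, (∀ j, wnorm r (A j) + wnorm s ((K - ident n) j) ≤ s) →
        ∀ j, wnorm r (X j) ≤ s := by
  set k := K - ident n with hkdef
  have hk : EqBelow 2 k 0 := by
    simpa using hK.sub (EqBelow.refl 2 (ident n))
  have hk0 : k.NoConst := noConst_iff.2 (hk.mono (by norm_num))
  -- the iteration `X ↦ A - k ∘ X`
  let x : ℕ → FormalMap n := fun m => Nat.rec 0 (fun _ X => A - k.comp X) m
  have hx : ∀ m, x (m + 1) = A - k.comp (x m) := fun m => rfl
  have hx0 : ∀ m, (x m).NoConst := by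
    intro m
    induction m with
    | zero => intro j; exact map_zero _
    | succ m ih => rw [hx]; exact hA.sub (hk0.comp ih)
  have hstab : ∀ m, EqBelow (m + 1) (x (m + 1)) (x m) := by
    intro m
    induction m with
    | zero => exact (noConst_iff.1 (hx0 1)).trans (noConst_iff.1 (hx0 0)).symm
    | succ m ih =>
      rw [hx (m + 1), hx m]
      exact (EqBelow.refl _ A).sub (ih.comp_right (hx0 (m + 1)) (hx0 m) hk)
  obtain ⟨X, hX⟩ := exists_limit hstab
  have hX0 : X.NoConst := (hX 0).noConst (hx0 0)
  refine ⟨X, hX0, ?_, fun r s hrs j => ?_⟩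
  · have hKX : K.comp X = X + k.comp X := by
      rw [hkdef, sub_comp _ _ hX0, ident_comp hX0]; abel
    refine eq_of_eqBelow fun d => ?_
    rw [hKX]
    have h1 := (hX (d + 1)).add (((hX d).comp_right hX0 (hx0 d) hk).mono
      (by omega : d + 1 + 1 ≤ d + 2))
    rw [hx, sub_add_cancel] at h1
    exact h1.mono (by omega)
  · refine wnorm_le_of_approx fun d => ⟨x d, (hX d).mono (by omega), ?_⟩
    have : ∀ m j, wnorm r (x m j) ≤ s := by
      intro m
      induction m with
      | zero => intro j; exact (wnorm_zero r).le.trans zero_le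
      | succ m ih =>
        intro j
        rw [hx]
        refine (wnorm_sub_le _ _ _).trans (le_trans ?_ (hrs j))
        gcongr
        exact wnorm_comp_le (hx0 m) ih k j
    exact this d j

end FormalMap

/-! ### The linearized conjugacy equation -/

variable {l : ℕ}

open FormalMap

theorem coeff_ident_mul (μ : Fin n → ℂ) (j : Fin n) (Q : Fin n →₀ ℕ) :
    (∏ k, μ k ^ Q k) * coeff Q (ident n j) = μ j * coeff Q (ident n j) := by
  rw [← coeff_comp_diag, ← coeff_diag_comp μ noConst_ident, ident_comp (noConst_diag μ),
    comp_ident]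

theorem prod_eq_of_smallDivisor_eq_zero {μ : Fin l → Fin n → ℂ} {Q : Fin n →₀ ℕ} {j : Fin n}
    (h : smallDivisor μ Q j = 0) (i : Fin l) : ∏ k, μ i k ^ Q k = μ i j :=
  sub_eq_zero.1 (congr_fun (norm_eq_zero.1 h) i)

/-- The terms `x^Q e_j` of degree `< d` of `f` with a nonzero divisor `max_i |μ_i^Q - μ_{i,j}|`. -/
noncomputable def nonresPart (μ : Fin l → Fin n → ℂ) (d : ℕ) (f : FormalMap n) : FormalMap n :=
  fun j Q => open Classical in
    if Q.degree < d ∧ smallDivisor μ Q j ≠ 0 then coeff Q (f j) else 0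

/-- The terms `x^Q e_j` of degree `< d` of `f` which commute with all the `diag (μ i)`. -/
noncomputable def resPart (μ : Fin l → Fin n → ℂ) (d : ℕ) (f : FormalMap n) : FormalMap n :=
  fun j Q => open Classical in
    if Q.degree < d ∧ smallDivisor μ Q j = 0 then coeff Q (f j) else 0

theorem coeff_nonresPart (μ : Fin l → Fin n → ℂ) (d : ℕ) (f : FormalMap n) (j : Fin n)
    (Q : Fin n →₀ ℕ) : coeff Q (nonresPart μ d f j) = open Classical in
      if Q.degree < d ∧ smallDivisor μ Q j ≠ 0 then coeff Q (f j) else 0 := rfl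

theorem coeff_resPart (μ : Fin l → Fin n → ℂ) (d : ℕ) (f : FormalMap n) (j : Fin n)
    (Q : Fin n →₀ ℕ) : coeff Q (resPart μ d f j) = open Classical in
      if Q.degree < d ∧ smallDivisor μ Q j = 0 then coeff Q (f j) else 0 := rfl

theorem nonresPart_add_resPart (μ : Fin l → Fin n → ℂ) (d : ℕ) (f : FormalMap n) :
    EqBelow d (nonresPart μ d f + resPart μ d f) f := by
  intro j Q hQ
  rw [Pi.add_apply, map_add, coeff_nonresPart, coeff_resPart]
  by_cases h : smallDivisor μ Q j = 0 <;> simp [hQ, h]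

theorem nonresPart_eqBelow_zero (μ : Fin l → Fin n → ℂ) (d : ℕ) {e : ℕ} {f : FormalMap n}
    (hf : EqBelow e f 0) : EqBelow e (nonresPart μ d f) 0 := by
  intro j Q hQ
  rw [coeff_nonresPart, hf j Q hQ]; simp

theorem resPart_eqBelow_zero (μ : Fin l → Fin n → ℂ) (d : ℕ) {e : ℕ} {f : FormalMap n}
    (hf : EqBelow e f 0) : EqBelow e (resPart μ d f) 0 := by
  intro j Q hQ
  rw [coeff_resPart, hf j Q hQ]; simp

theorem diag_comp_ident_sub_resPart (μ : Fin l → Fin n → ℂ) (d : ℕ) (f : FormalMap n)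
    (h0 : (ident n - resPart μ d f).NoConst) (i : Fin l) :
    (diag (μ i)).comp (ident n - resPart μ d f) =
      (ident n - resPart μ d f).comp (diag (μ i)) := by
  funext j
  ext Q
  rw [coeff_diag_comp _ h0, coeff_comp_diag, Pi.sub_apply, map_sub, mul_sub, mul_sub,
    coeff_ident_mul]
  congr 1
  rw [coeff_resPart]
  split_ifs with h
  · rw [prod_eq_of_smallDivisor_eq_zero h.2]
  · simp

/-- If `D ∘ G` is linearized by `Ψ`, where `G = id + g` and `Ψ = id + ψ` with `g`, `ψ` of order
`> m`, then in degrees `≤ 2m` the conjugacy equation is the linear equation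
`D g = ψ ∘ D - D ψ`. -/
theorem linearized_equation {m : ℕ} {μ : Fin n → ℂ} {G Ψ : FormalMap n}
    (hG : EqBelow (m + 1) G (ident n)) (hΨ : EqBelow (m + 1) Ψ (ident n))
    (h : (diag μ).comp (G.comp Ψ) = Ψ.comp (diag μ)) (j : Fin n) (Q : Fin n →₀ ℕ)
    (hQ : Q.degree < 2 * m + 1) :
    μ j * (coeff Q ((G - ident n) j) + coeff Q ((Ψ - ident n) j)) =
      (∏ k, μ k ^ Q k) * coeff Q ((Ψ - ident n) j) := by
  have hΨ0 : Ψ.NoConst := hΨ.noConst noConst_ident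
  have hG0 : G.NoConst := hG.noConst noConst_ident
  have hg : EqBelow (m + 1) (G - ident n) 0 := by simpa using hG.sub (EqBelow.refl _ (ident n))
  have h1 : G.comp Ψ = Ψ + (G - ident n).comp Ψ := by
    rw [sub_comp _ _ hΨ0, ident_comp hΨ0]; abel
  have h2 := hΨ.comp_right hΨ0 noConst_ident hg j Q (by omega)
  rw [comp_ident] at h2
  have h3 := congr_arg (coeff Q) (congr_fun h j)
  rw [coeff_diag_comp _ (hG0.comp hΨ0), coeff_comp_diag, h1, Pi.add_apply, map_add, h2] at h3
  have h4 := coeff_ident_mul μ j Q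
  rw [Pi.sub_apply Ψ, map_sub, mul_sub, h4, ← h3]
  ring

/-- If the inverses of the nonzero divisors are at most `w`, the nonresonant solution of the
linearized equation is bounded by the perturbation, coefficient by coefficient: as the equation
holds for every `i`, it may be divided by the largest of the numbers `|μ_i^Q - μ_{i,j}|`. -/
theorem norm_coeff_nonresPart_le {m : ℕ} {μ : Fin l → Fin n → ℂ} {G : Fin l → FormalMap n}
    {Ψ : FormalMap n} {w M : ℝ} (hM : ∀ i j, ‖μ i j‖ ≤ M) (hm : 1 ≤ m)
    (hw : ∀ (Q : Fin n →₀ ℕ) (j : Fin n), 2 ≤ Q.degree → Q.degree ≤ 2 * m →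
      smallDivisor μ Q j ≠ 0 → (smallDivisor μ Q j)⁻¹ ≤ w)
    (hw0 : 0 ≤ w) (hM0 : 0 ≤ M)
    (hG : ∀ i, EqBelow (m + 1) (G i) (ident n)) (hΨ : EqBelow (m + 1) Ψ (ident n))
    (h : ∀ i, (diag (μ i)).comp ((G i).comp Ψ) = Ψ.comp (diag (μ i))) (j : Fin n)
    (Q : Fin n →₀ ℕ) :
    ‖coeff Q (nonresPart μ (2 * m + 1) (Ψ - ident n) j)‖ ≤
      w * M * ∑ i, ‖coeff Q ((G i - ident n) j)‖ := by
  have hsum : 0 ≤ ∑ i, ‖coeff Q ((G i - ident n) j)‖ :=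
    Finset.sum_nonneg fun i _ => norm_nonneg _
  rw [coeff_nonresPart]
  split_ifs with hc
  swap
  · rw [norm_zero]; positivity
  obtain ⟨hQ, hδ⟩ := hc
  by_cases hQ2 : Q.degree < 2
  · have := hΨ j Q (hQ2.trans_le (Nat.succ_le_succ hm))
    rw [Pi.sub_apply, map_sub, this, sub_self, norm_zero]; positivity
  have hδ0 : 0 < smallDivisor μ Q j := lt_of_le_of_ne (norm_nonneg _) hδ.symm
  have key : smallDivisor μ Q j * ‖coeff Q ((Ψ - ident n) j)‖ ≤
      M * ∑ i, ‖coeff Q ((G i - ident n) j)‖ := by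
    have : smallDivisor μ Q j * ‖coeff Q ((Ψ - ident n) j)‖ =
        ‖coeff Q ((Ψ - ident n) j) • (fun i => (∏ k, μ i k ^ Q k) - μ i j : Fin l → ℂ)‖ := by
      rw [norm_smul, mul_comm]; rfl
    rw [this]
    refine (pi_norm_le_iff_of_nonneg (by positivity)).2 fun i => ?_
    have h1 := linearized_equation (hG i) hΨ (h i) j Q hQ
    have h2 : (coeff Q ((Ψ - ident n) j) • (fun i => (∏ k, μ i k ^ Q k) - μ i j : Fin l → ℂ)) i =
        μ i j * coeff Q ((G i - ident n) j) := by
      simp only [Pi.smul_apply, smul_eq_mul]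
      linear_combination -h1
    rw [h2, norm_mul]
    refine mul_le_mul (hM i j) ?_ (norm_nonneg _) hM0
    exact Finset.single_le_sum (f := fun i => ‖coeff Q ((G i - ident n) j)‖)
      (fun i _ => norm_nonneg _) (Finset.mem_univ i)
  calc ‖coeff Q ((Ψ - ident n) j)‖
      = (smallDivisor μ Q j)⁻¹ * (smallDivisor μ Q j * ‖coeff Q ((Ψ - ident n) j)‖) := by
        field_simp
    _ ≤ w * (M * ∑ i, ‖coeff Q ((G i - ident n) j)‖) :=
        mul_le_mul (hw Q j (not_lt.1 hQ2) (by omega) hδ) key (by positivity) hw0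
    _ = _ := by ring

/-- The coefficients of `D⁻¹ ∘ (id + h) ∘ D - id`. -/
theorem coeff_conj_diag_sub {μ : Fin n → ℂ} (hμ : ∀ j, μ j ≠ 0) {h : FormalMap n}
    (hh : h.NoConst) (j : Fin n) (Q : Fin n →₀ ℕ) :
    coeff Q (((diag μ⁻¹).comp ((ident n + h).comp (diag μ)) - ident n) j) =
      (μ j)⁻¹ * ((∏ k, μ k ^ Q k) * coeff Q (h j)) := by
  rw [Pi.sub_apply, map_sub, coeff_diag_comp _ ((noConst_ident.add hh).comp (noConst_diag μ)),
    coeff_comp_diag, Pi.add_apply, map_add, mul_add, coeff_ident_mul, Pi.inv_apply, mul_add,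
    inv_mul_cancel_left₀ (hμ j)]
  ring

/-- No domain is lost to the possible expansion of `D`: for the solution `h` of the linearized
equation, `D⁻¹ ∘ h ∘ D` is no larger than `h` and `g` together. -/
theorem enorm_coeff_conj_diag_sub_le {m : ℕ} {μ : Fin l → Fin n → ℂ} (hμ : ∀ i j, μ i j ≠ 0)
    {G : Fin l → FormalMap n} {Ψ : FormalMap n}
    (hG : ∀ i, EqBelow (m + 1) (G i) (ident n)) (hΨ : EqBelow (m + 1) Ψ (ident n))
    (h : ∀ i, (diag (μ i)).comp ((G i).comp Ψ) = Ψ.comp (diag (μ i)))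
    (hh : (nonresPart μ (2 * m + 1) (Ψ - ident n)).NoConst) (i : Fin l) (j : Fin n)
    (Q : Fin n →₀ ℕ) :
    ‖coeff Q (((diag (μ i)⁻¹).comp ((ident n + nonresPart μ (2 * m + 1) (Ψ - ident n)).comp
      (diag (μ i))) - ident n) j)‖ₑ ≤
      ‖coeff Q (nonresPart μ (2 * m + 1) (Ψ - ident n) j)‖ₑ +
        ‖coeff Q ((G i - ident n) j)‖ₑ := by
  rw [coeff_conj_diag_sub (hμ i) hh, coeff_nonresPart]
  split_ifs with hc
  · have h1 := linearized_equation (hG i) hΨ (h i) j Q hc.1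
    rw [← h1, inv_mul_cancel_left₀ (hμ i j), add_comm]
    exact enorm_add_le _ _
  · simp

/-! ### The Newton step -/

/-- The formal maps `F i` have been conjugated by `Θ` to `diag (μ i) ∘ G i`, where `G i` is tangent to
the identity to order `m`, with bounds on the polydisc of radius `r`; the conjugated maps are still
formally linearizable, by `Ψ`. -/
structure PartialLinearization (μ : Fin l → Fin n → ℂ) (F : Fin l → FormalMap n) (m : ℕ)
    (s r : ℝ≥0∞) (Θ : FormalMap n) (G : Fin l → FormalMap n) (Ψ : FormalMap n) : Prop where
  tangent : EqBelow 2 Θ (ident n)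
  perturbation_order : ∀ i, EqBelow (m + 1) (G i) (ident n)
  linearizer_order : EqBelow (m + 1) Ψ (ident n)
  conj : ∀ i, (F i).comp Θ = Θ.comp ((diag (μ i)).comp (G i))
  linearizes : ∀ i, (diag (μ i)).comp ((G i).comp Ψ) = Ψ.comp (diag (μ i))
  bound : ∀ j, wnorm r (Θ j) ≤ s
  perturbation_bound : ∀ i j, wnorm r ((G i - ident n) j) ≤ r

/-- One Newton step, doubling the order of the perturbation. With `ψ = Ψ - id`, the germs are
conjugated by `H = id + h`, where `h` is the nonresonant part of `ψ` in degrees `≤ 2m`. The resonant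
part is discarded: it commutes with all the `D i`, so `Ψ` can be corrected by it. The new
perturbation `G'` is defined by `(D⁻¹ ∘ H ∘ D) ∘ G' = G ∘ H`, which only involves maps close to the
identity. On the polydisc of radius `t * r` all of `h`, `G - id` and `D⁻¹ ∘ H ∘ D - id` are at most
`e`, since they have order `> m`. -/
theorem PartialLinearization.step {μ : Fin l → Fin n → ℂ} (hμ : ∀ i j, μ i j ≠ 0)
    {F : Fin l → FormalMap n} {m : ℕ} {s r : ℝ≥0∞} {Θ : FormalMap n}
    {G : Fin l → FormalMap n} {Ψ : FormalMap n}
    (S : PartialLinearization μ F m s r Θ G Ψ) (hm : 1 ≤ m)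
    {w M : ℝ} (hM : ∀ i j, ‖μ i j‖ ≤ M)
    (hw : ∀ (Q : Fin n →₀ ℕ) (j : Fin n), 2 ≤ Q.degree → Q.degree ≤ 2 * m →
      smallDivisor μ Q j ≠ 0 → (smallDivisor μ Q j)⁻¹ ≤ w)
    (hw0 : 0 ≤ w) (hM0 : 0 ≤ M) {t e r' : ℝ≥0∞} (ht : t ≤ 1)
    (he : (1 + ENNReal.ofReal (w * M * l)) * (t ^ (m + 1) * r) ≤ e)
    (hr' : r' + 3 * e ≤ t * r) (her' : 3 * e ≤ r') :
    ∃ Θ' G' Ψ', PartialLinearization μ F (2 * m) s r' Θ' G' Ψ' ∧ EqBelow (m + 1) Θ' Θ := by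
  have hI : ∀ {d : ℕ} {f : FormalMap n}, EqBelow d f (ident n) → EqBelow d (f - ident n) 0 :=
    fun h => by simpa using h.sub (EqBelow.refl _ (ident n))
  have hG0 : ∀ i, (G i).NoConst := fun i => (S.perturbation_order i).noConst noConst_ident
  have hΨ0 : Ψ.NoConst := S.linearizer_order.noConst noConst_ident
  have hΘ0 : Θ.NoConst := (S.tangent.mono (by norm_num : 0 + 1 ≤ 2)).noConst noConst_ident
  have hD0 : ∀ i, (diag (μ i)).NoConst := fun i => noConst_diag _
  have hDi0 : ∀ i, (diag (μ i)⁻¹).NoConst := fun i => noConst_diag _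
  set h := nonresPart μ (2 * m + 1) (Ψ - ident n) with hh
  set R := ident n - resPart μ (2 * m + 1) (Ψ - ident n) with hR
  set H := ident n + h with hH
  have hψ : EqBelow (m + 1) (Ψ - ident n) 0 := hI S.linearizer_order
  have hhm : EqBelow (m + 1) h 0 := nonresPart_eqBelow_zero _ _ hψ
  have hh0 : h.NoConst := noConst_iff.2 (hhm.mono (by omega))
  have hHm : EqBelow (m + 1) H (ident n) := by simpa using (EqBelow.refl _ (ident n)).add hhm
  have hH2 : EqBelow 2 H (ident n) := hHm.mono (by omega)
  have hH0 : H.NoConst := noConst_ident.add hh0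
  have hRm : EqBelow (m + 1) R (ident n) := by
    simpa using (EqBelow.refl _ (ident n)).sub (resPart_eqBelow_zero μ (2 * m + 1) hψ)
  have hR0 : R.NoConst := hRm.noConst noConst_ident
  set K : Fin l → FormalMap n := fun i => (diag (μ i)⁻¹).comp (H.comp (diag (μ i))) with hK
  have hK2 : ∀ i, EqBelow 2 (K i) (ident n) := by
    intro i
    have h1 := (EqBelow.refl 2 (diag (μ i)⁻¹)).comp (hH2.comp_left (hD0 i)) (hDi0 i)
      (hH0.comp (hD0 i)) (noConst_ident.comp (hD0 i))
    rwa [ident_comp (hD0 i), diag_inv_comp_diag (hμ i)] at h1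
  have hK0 : ∀ i, (K i).NoConst := fun i => (hDi0 i).comp (hH0.comp (hD0 i))
  choose G' hG'0 hG'eq hG'bound using
    fun i => exists_comp_eq (hK2 i) ((hG0 i).comp hH0)
  obtain ⟨Ψ', hΨ'0, hΨ'eq, -⟩ := exists_comp_eq hH2 (hΨ0.comp hR0)
  -- `H ∘ D ∘ G' = D ∘ G ∘ H`
  have hconj : ∀ i, H.comp ((diag (μ i)).comp (G' i)) = (diag (μ i)).comp ((G i).comp H) := by
    intro i
    rw [← hG'eq i, ← comp_assoc _ (hK0 i) (hG'0 i)]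
    simp only [hK]
    rw [← comp_assoc _ (hDi0 i) (hH0.comp (hD0 i)), diag_comp_diag_inv (hμ i),
      ident_comp (hH0.comp (hD0 i)), comp_assoc _ (hD0 i) (hG'0 i)]
  have hlin : ∀ i, (diag (μ i)).comp ((G' i).comp Ψ') = Ψ'.comp (diag (μ i)) := by
    intro i
    refine comp_left_cancel hH2 ((hD0 i).comp ((hG'0 i).comp hΨ'0)) (hΨ'0.comp (hD0 i)) ?_
    rw [← comp_assoc _ hΨ'0 (hD0 i), hΨ'eq, ← comp_assoc _ (hG'0 i) hΨ'0,
      ← comp_assoc _ ((hD0 i).comp (hG'0 i)) hΨ'0, hconj i,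
      comp_assoc _ ((hG0 i).comp hH0) hΨ'0, comp_assoc _ hH0 hΨ'0, hΨ'eq,
      ← comp_assoc _ hΨ0 hR0, ← comp_assoc _ ((hG0 i).comp hΨ0) hR0, S.linearizes i,
      comp_assoc _ (hD0 i) hR0, diag_comp_ident_sub_resPart _ _ _ hR0,
      comp_assoc _ hR0 (hD0 i)]
  -- `Ψ ∘ R` and `H` have the same jet of order `2m`: the gain is that `ψ ∘ R - ψ` has order `> 2m`
  have hΨ'm : EqBelow (2 * m + 1) Ψ' (ident n) := by
    refine EqBelow.of_comp hH2 hΨ'0 noConst_ident ?_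
    rw [hΨ'eq, comp_ident]
    have h1 : Ψ.comp R = R + (Ψ - ident n).comp R := by
      rw [sub_comp _ _ hR0, ident_comp hR0]; abel
    have h2 : EqBelow (2 * m + 1) ((Ψ - ident n).comp R) (Ψ - ident n) := by
      have := hRm.comp_right hR0 noConst_ident hψ
      rw [comp_ident] at this
      exact this.mono (by omega)
    have h3 := ((EqBelow.refl _ R).add h2).trans
      ((EqBelow.refl _ R).add (nonresPart_add_resPart μ (2 * m + 1) (Ψ - ident n)).symm)
    have h4 : R + (nonresPart μ (2 * m + 1) (Ψ - ident n) +
        resPart μ (2 * m + 1) (Ψ - ident n)) = H := by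
      rw [hR, hH, hh]; abel
    rw [h4, ← h1] at h3
    exact h3
  -- a map linearized by one tangent to the identity to order `2m` is linear to that order
  have hG'm : ∀ i, EqBelow (2 * m + 1) (G' i) (ident n) := by
    intro i
    have h1 : (G' i).comp Ψ' = (diag (μ i)⁻¹).comp (Ψ'.comp (diag (μ i))) := by
      rw [← hlin i, ← comp_assoc _ (hD0 i) ((hG'0 i).comp hΨ'0), diag_inv_comp_diag (hμ i),
        ident_comp ((hG'0 i).comp hΨ'0)]
    have h2 := (EqBelow.refl _ (diag (μ i)⁻¹)).comp (hΨ'm.comp_left (hD0 i)) (hDi0 i)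
      (hΨ'0.comp (hD0 i)) (noConst_ident.comp (hD0 i))
    rw [ident_comp (hD0 i), diag_inv_comp_diag (hμ i), ← h1] at h2
    have h3 := hΨ'm.comp_right hΨ'0 noConst_ident (noConst_iff.1 (hG'0 i))
    rw [comp_ident] at h3
    exact (h3.symm).trans h2
  -- estimates on the polydisc of radius `t * r`
  set B := t ^ (m + 1) * r with hB
  have hg : ∀ i j, wnorm (t * r) ((G i - ident n) j) ≤ B := fun i j =>
    (wnorm_mul_radius_le ht fun Q hQ => by simpa using hI (S.perturbation_order i) j Q hQ).trans
      (mul_le_mul_right (S.perturbation_bound i j) _)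
  have hhB : ∀ j, wnorm (t * r) (h j) ≤ ENNReal.ofReal (w * M * l) * B := by
    intro j
    calc wnorm (t * r) (h j)
        ≤ ∑' Q : Fin n →₀ ℕ, ENNReal.ofReal (w * M) *
            ∑ i, ‖coeff Q ((G i - ident n) j)‖ₑ * (t * r) ^ Q.degree := by
          refine ENNReal.tsum_le_tsum fun Q => ?_
          rw [← Finset.sum_mul, ← mul_assoc]
          refine mul_le_mul_left ?_ _
          have h1 := ENNReal.ofReal_le_ofReal (norm_coeff_nonresPart_le hM hm hw hw0 hM0
            S.perturbation_order S.linearizer_order S.linearizes j Q)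
          rw [ENNReal.ofReal_mul (by positivity),
            ENNReal.ofReal_sum_of_nonneg (fun i _ => norm_nonneg _)] at h1
          simpa [ofReal_norm] using h1
      _ = ENNReal.ofReal (w * M) * ∑ i, wnorm (t * r) ((G i - ident n) j) := by
          rw [ENNReal.tsum_mul_left, Summable.tsum_finsetSum fun i _ => ENNReal.summable]
          rfl
      _ ≤ ENNReal.ofReal (w * M) * ∑ _i : Fin l, B := by
          gcongr with i; exact hg i j
      _ = ENNReal.ofReal (w * M * l) * B := by
          rw [ENNReal.ofReal_mul (p := w * M) (by positivity)]
          simp [mul_assoc]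
  have he1 : ∀ i j, wnorm (t * r) ((G i - ident n) j) ≤ e := fun i j =>
    (hg i j).trans (le_trans (by rw [add_mul, one_mul]; exact le_self_add) he)
  have he2 : ∀ j, wnorm (t * r) (h j) ≤ e := fun j =>
    (hhB j).trans (le_trans (by rw [add_mul, one_mul]; exact le_add_self) he)
  have he3 : ∀ i j, wnorm (t * r) ((K i - ident n) j) ≤ e := by
    intro i j
    refine le_trans ?_ he
    calc wnorm (t * r) ((K i - ident n) j)
        ≤ wnorm (t * r) (h j) + wnorm (t * r) ((G i - ident n) j) := by
          unfold wnorm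
          rw [← ENNReal.tsum_add]
          refine ENNReal.tsum_le_tsum fun Q => ?_
          rw [← add_mul]
          gcongr
          exact enorm_coeff_conj_diag_sub_le hμ S.perturbation_order S.linearizer_order
            S.linearizes hh0 i j Q
      _ ≤ ENNReal.ofReal (w * M * l) * B + B := add_le_add (hhB j) (hg i j)
      _ = _ := by ring
  have hrr : r' ≤ t * r := le_self_add.trans hr'
  have hr3 : r' + e + e + e ≤ t * r := le_trans (le_of_eq (by ring)) hr'
  have hh1 : ∀ j, wnorm r' (h j) ≤ e := fun j => (wnorm_mono hrr _).trans (he2 j)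
  have hHr : ∀ j, wnorm r' (H j) ≤ r' + e := fun j => by
    refine (wnorm_add_le _ _ _).trans (add_le_add ?_ (hh1 j))
    exact (wnorm_X r' j).le
  have hHr' : ∀ j, wnorm r' (H j) ≤ t * r := fun j =>
    (hHr j).trans (le_trans (by rw [add_assoc (r' + e)]; exact le_self_add) hr3)
  have hgH : ∀ i j, wnorm r' ((G i - ident n).comp H j) ≤ e := fun i j =>
    (wnorm_comp_le hH0 hHr' _ j).trans (he1 i j)
  have hGH : ∀ i, (G i).comp H = H + (G i - ident n).comp H := fun i => by
    rw [sub_comp _ _ hH0, ident_comp hH0]; abel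
  have hG'r : ∀ i j, wnorm r' (G' i j) ≤ t * r := by
    intro i j
    refine hG'bound i r' (t * r) (fun j => ?_) j
    rw [hGH]
    refine le_trans (add_le_add ((wnorm_add_le _ _ _).trans
      (add_le_add (hHr j) (hgH i j))) (he3 i j)) hr3
  refine ⟨Θ.comp H, G', Ψ', ⟨?_, ?_, ?_, ?_, hlin, ?_, ?_⟩, ?_⟩
  · have := S.tangent.comp hH2 noConst_ident hH0 noConst_ident
    rwa [comp_ident] at this
  · exact hG'm
  · exact hΨ'm
  · intro i
    rw [← comp_assoc _ hΘ0 hH0, S.conj i, comp_assoc _ ((hD0 i).comp (hG0 i)) hH0,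
      comp_assoc _ (hG0 i) hH0, ← hconj i, comp_assoc _ hH0 ((hD0 i).comp (hG'0 i))]
  · intro j
    refine (wnorm_comp_le hH0 (fun j => ?_) Θ j).trans (S.bound j)
    refine (hHr' j).trans ?_
    calc t * r ≤ 1 * r := by gcongr
      _ = r := one_mul r
  · intro i j
    have h1 : G' i - ident n = h + (G i - ident n).comp H - (K i - ident n).comp (G' i) := by
      have h2 : (G i).comp H = G' i + (K i - ident n).comp (G' i) := by
        rw [sub_comp _ _ (hG'0 i), ident_comp (hG'0 i), hG'eq]; abel
      have h3 : (G i).comp H = ident n + h + (G i - ident n).comp H := hGH i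
      rw [eq_sub_iff_add_eq, sub_add_eq_add_sub, ← h2, h3]; abel
    rw [h1]
    refine le_trans ?_ her'
    refine (wnorm_sub_le _ _ _).trans (le_trans (add_le_add ((wnorm_add_le _ _ _).trans
      (add_le_add (hh1 j) (hgH i j)))
      ((wnorm_comp_le (hG'0 i) (hG'r i) _ j).trans (he3 i j))) (le_of_eq (by ring)))
  · have := (EqBelow.refl (m + 1) Θ).comp hHm hΘ0 hH0 noConst_ident
    rwa [comp_ident] at this

/-! ### The radii, and the Brjuno condition -/

theorem omega_nonneg (μ : Fin l → Fin n → ℂ) (k : ℕ) : 0 ≤ omega μ k := by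
  refine Real.sInf_nonneg ?_
  rintro r ⟨-, Q, j, -, -, rfl⟩
  exact norm_nonneg _

theorem inv_smallDivisor_le (μ : Fin l → Fin n → ℂ) {k : ℕ} {Q : Fin n →₀ ℕ} {j : Fin n}
    (h2 : 2 ≤ Q.degree) (hk : Q.degree ≤ 2 ^ k) (h0 : smallDivisor μ Q j ≠ 0) :
    (smallDivisor μ Q j)⁻¹ ≤ (omega μ k)⁻¹ := by
  set S := {r : ℝ | r ≠ 0 ∧ ∃ (Q : Fin n →₀ ℕ) (j : Fin n),
    2 ≤ Q.degree ∧ Q.degree ≤ 2 ^ k ∧ r = smallDivisor μ Q j} with hS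
  have hfin : S.Finite := by
    refine Set.Finite.subset (((Finsupp.finite_of_degree_le (2 ^ k)).prod
      (Set.finite_univ (α := Fin n))).image fun p => smallDivisor μ p.1 p.2) ?_
    rintro r ⟨-, Q, j, -, hQ, rfl⟩
    exact ⟨(Q, j), ⟨hQ, Set.mem_univ _⟩, rfl⟩
  have hmem : smallDivisor μ Q j ∈ S := ⟨h0, Q, j, h2, hk, rfl⟩
  have hle : omega μ k ≤ smallDivisor μ Q j := csInf_le hfin.bddBelow hmem
  have hne : omega μ k ≠ 0 := (Set.Nonempty.csInf_mem ⟨_, hmem⟩ hfin).1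
  exact inv_anti₀ (lt_of_le_of_ne (omega_nonneg μ k) hne.symm) hle

/-- For `w = 0` this relies on `0⁻¹ = 0` and `log 0 = 0`, the values which `omega` yields where
there is no nonzero divisor. -/
theorem log_one_add_mul_inv_le {C w : ℝ} (hC : 0 ≤ C) (hw : 0 ≤ w) :
    Real.log (1 + C * w⁻¹) ≤ Real.log (1 + C) + |Real.log w| := by
  rcases hw.eq_or_lt with rfl | hw
  · simpa using Real.log_nonneg (by linarith : (1 : ℝ) ≤ 1 + C)
  · have h1 : 1 ≤ Real.exp |Real.log w| := Real.one_le_exp (abs_nonneg _)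
    have h2 : w⁻¹ ≤ Real.exp |Real.log w| := by
      rw [← Real.exp_log (inv_pos.2 hw), Real.log_inv]
      exact Real.exp_le_exp.2 (neg_le_abs _)
    have h3 : 1 + C * w⁻¹ ≤ (1 + C) * Real.exp |Real.log w| := by
      nlinarith [mul_le_mul_of_nonneg_left h2 hC]
    calc Real.log (1 + C * w⁻¹) ≤ Real.log ((1 + C) * Real.exp |Real.log w|) :=
          Real.log_le_log (by positivity) h3
      _ = _ := by rw [Real.log_mul (by positivity) (by positivity), Real.log_exp]

theorem summable_log_one_add_div_omega {μ : Fin l → Fin n → ℂ} (hD : IsDiophantine μ) {C : ℝ}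
    (hC : 0 ≤ C) :
    Summable fun k : ℕ => Real.log (1 + C * (omega μ (k + 1))⁻¹) / 2 ^ k := by
  have hgeom : Summable fun k : ℕ => ((1 : ℝ) / 2) ^ k := summable_geometric_two
  refine Summable.of_nonneg_of_le (fun k => ?_) (fun k => ?_)
    ((hgeom.mul_left (Real.log (1 + C))).add (hD.abs.mul_left 2))
  · have := omega_nonneg μ (k + 1)
    exact div_nonneg (Real.log_nonneg (le_add_of_nonneg_right (by positivity))) (by positivity)
  · have h := log_one_add_mul_inv_le hC (omega_nonneg μ (k + 1))
    calc _ ≤ (Real.log (1 + C) + |Real.log (omega μ (k + 1))|) / 2 ^ k := by gcongr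
      _ = _ := by
        rw [abs_div, abs_neg, abs_of_pos (by positivity : (0 : ℝ) < 2 ^ (k + 1)), pow_succ,
          one_div, inv_pow]
        field_simp

/-- The radii of the Newton scheme. If `∑ log (W k) / 2 ^ k` converges, radii `r k` and factors
`t k ≤ 1` can be chosen so that the errors `e k` of the Newton steps are small compared with the
loss of radius, while the `r k` stay bounded away from zero. -/
theorem exists_radii {W : ℕ → ℝ} (hW : ∀ k, 1 ≤ W k)
    (hsum : Summable fun k : ℕ => Real.log (W k) / 2 ^ k) {R : ℝ} (hR : 0 < R) :
    ∃ r t e : ℕ → ℝ, r 0 = R ∧ (∀ k, 0 ≤ r k) ∧ (∀ k, 0 ≤ t k) ∧ (∀ k, t k ≤ 1) ∧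
      (∀ k, 0 ≤ e k) ∧
      (∀ k, W k * (t k ^ (2 ^ k + 1) * r k) ≤ e k) ∧ (∀ k, r (k + 1) + 3 * e k ≤ t k * r k) ∧
      (∀ k, 3 * e k ≤ r (k + 1)) ∧ ∃ r₀ > 0, ∀ k, r₀ ≤ r k := by
  -- `e k = (u k / 16) * t k * r k`, and `t k` is the solution of `W k * t k ^ 2 ^ k = u k / 16`
  set u : ℕ → ℝ := fun k => (1 / 2) ^ k with hu
  have hu0 : ∀ k, 0 < u k := fun k => by positivity
  have hu1 : ∀ k, u k ≤ 1 := fun k => pow_le_one₀ (by norm_num) (by norm_num)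
  set b : ℕ → ℝ := fun k => (Real.log (16 * 2 ^ k) + Real.log (W k)) / 2 ^ k with hb
  have hlog : ∀ k : ℕ, 0 ≤ Real.log (16 * 2 ^ k) := fun k => Real.log_nonneg (by
    have : (1 : ℝ) ≤ 2 ^ k := one_le_pow₀ (by norm_num)
    linarith)
  have hb0 : ∀ k, 0 ≤ b k := fun k =>
    div_nonneg (add_nonneg (hlog k) (Real.log_nonneg (hW k))) (by positivity)
  have hgeom : Summable u := summable_geometric_two
  have hbsum : Summable b := by
    have h1 : Summable fun k : ℕ => (k : ℝ) ^ 1 * ((1 : ℝ) / 2) ^ k :=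
      summable_pow_mul_geometric_of_norm_lt_one 1 (by norm_num)
    refine (((hgeom.mul_left (Real.log 16)).add (h1.mul_left (Real.log 2))).add hsum).congr
      fun k => ?_
    simp only [hb, hu]
    rw [Real.log_mul (by norm_num) (by positivity), Real.log_pow, one_div, inv_pow]
    field_simp
  set c : ℕ → ℝ := fun k => b k + u k with hc
  have hcsum : Summable c := hbsum.add hgeom
  have hc0 : ∀ k, 0 ≤ c k := fun k => add_nonneg (hb0 k) (hu0 k).le
  set r : ℕ → ℝ := fun k => R * Real.exp (-∑ j ∈ Finset.range k, c j) with hr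
  have hr0 : ∀ k, 0 < r k := fun k => by positivity
  set t : ℕ → ℝ := fun k => Real.exp (-b k) with ht
  have hrsucc : ∀ k, r (k + 1) = Real.exp (-u k) * (t k * r k) := by
    intro k
    simp only [hr, ht, Finset.sum_range_succ, hc]
    rw [neg_add, Real.exp_add, neg_add, Real.exp_add]
    ring
  have htr : ∀ k, 0 < t k * r k := fun k => mul_pos (Real.exp_pos _) (hr0 k)
  refine ⟨r, t, fun k => u k / 16 * (t k * r k), by simp [hr], fun k => (hr0 k).le,
    fun k => (Real.exp_pos _).le, fun k => Real.exp_le_one_iff.2 (neg_nonpos.2 (hb0 k)),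
    fun k => mul_nonneg (div_nonneg (hu0 k).le (by norm_num)) (htr k).le, fun k => ?_,
    fun k => ?_, fun k => ?_, R * Real.exp (-∑' j, c j), by positivity, fun k => ?_⟩
  · have hWk : 0 < W k := lt_of_lt_of_le one_pos (hW k)
    have h1 : t k ^ (2 ^ k) = u k / 16 * (W k)⁻¹ := by
      simp only [ht]
      rw [← Real.exp_nat_mul]
      have : ((2 ^ k : ℕ) : ℝ) * -b k = -(Real.log (16 * 2 ^ k) + Real.log (W k)) := by
        simp only [hb]; push_cast; field_simp
      rw [this, neg_add, Real.exp_add, Real.exp_neg, Real.exp_neg, Real.exp_log (by positivity),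
        Real.exp_log hWk, mul_inv]
      simp only [hu, one_div, inv_pow]
      ring
    rw [pow_succ, h1]
    refine le_of_eq ?_
    field_simp
  · rw [hrsucc]
    have h1 : Real.exp (-u k) + 3 * (u k / 16) ≤ 1 := by
      have h2 : Real.exp (-u k) ≤ (1 + u k)⁻¹ := by
        rw [Real.exp_neg]
        exact inv_anti₀ (by linarith [hu0 k]) (by linarith [Real.add_one_le_exp (u k)])
      have h3 : (1 + u k)⁻¹ ≤ 1 - 3 * (u k / 16) := by
        rw [inv_le_iff_one_le_mul₀ (by linarith [hu0 k])]
        nlinarith [hu0 k, hu1 k]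
      linarith
    nlinarith [mul_le_mul_of_nonneg_right h1 (htr k).le]
  · rw [hrsucc]
    have h1 : 3 * (u k / 16) ≤ Real.exp (-u k) := by
      have h2 : Real.exp (-1) ≤ Real.exp (-u k) := Real.exp_le_exp.2 (by linarith [hu1 k])
      have := Real.exp_neg_one_gt_d9
      linarith [hu1 k]
    nlinarith [mul_le_mul_of_nonneg_right h1 (htr k).le]
  · have : ∑ j ∈ Finset.range k, c j ≤ ∑' j, c j :=
      hcsum.sum_le_tsum _ fun j _ => hc0 j
    simp only [hr]
    gcongr

/-! ### Convergence of the Newton scheme -/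

/-- The Newton steps with `m = 2 ^ k` compose to a linearization `Θ'` which converges on a polydisc.
The steps agree with the identity up to order `2 ^ k`, so the limit exists formally, and the bound
by `s` passes to the limit. -/
theorem exists_bounded_linearization {μ : Fin l → Fin n → ℂ} (hμ : ∀ i j, μ i j ≠ 0)
    (hD : IsDiophantine μ) {F G : Fin l → FormalMap n} {Ψ : FormalMap n}
    (hF : ∀ i, (F i).NoConst) {s : ℝ≥0∞} {R : ℝ} (hR : 0 < R) {Θ : FormalMap n}
    (S : PartialLinearization μ F 1 s (ENNReal.ofReal R) Θ G Ψ) :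
    ∃ Θ' : FormalMap n, ∃ r₀ : ℝ, 0 < r₀ ∧ EqBelow 2 Θ' (ident n) ∧
      (∀ i, (F i).comp Θ' = Θ'.comp (diag (μ i))) ∧
      ∀ j, wnorm (ENNReal.ofReal r₀) (Θ' j) ≤ s := by
  set M : ℝ := ∑ i, ∑ j, ‖μ i j‖ with hMdef
  have hM0 : 0 ≤ M := Finset.sum_nonneg fun i _ => Finset.sum_nonneg fun j _ => norm_nonneg _
  have hM : ∀ i j, ‖μ i j‖ ≤ M := fun i j =>
    (Finset.single_le_sum (f := fun j => ‖μ i j‖) (fun j _ => norm_nonneg _)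
      (Finset.mem_univ j)).trans (Finset.single_le_sum (f := fun i => ∑ j, ‖μ i j‖)
        (fun i _ => Finset.sum_nonneg fun j _ => norm_nonneg _) (Finset.mem_univ i))
  have hC : 0 ≤ M * l := by positivity
  have hw0 : ∀ k, 0 ≤ (omega μ k)⁻¹ := fun k => inv_nonneg.2 (omega_nonneg μ k)
  have hW : ∀ k, 1 ≤ 1 + M * l * (omega μ (k + 1))⁻¹ := fun k =>
    le_add_of_nonneg_right (mul_nonneg hC (hw0 _))
  obtain ⟨r, t, e, hr0, hrn, htn, ht1, hen, h1, h2, h3, r₀, hr₀, hr₀r⟩ :=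
    exists_radii hW (summable_log_one_add_div_omega hD hC) hR
  have hstep : ∀ (k : ℕ) (x : {p : FormalMap n × (Fin l → FormalMap n) × FormalMap n //
      PartialLinearization μ F (2 ^ k) s (ENNReal.ofReal (r k)) p.1 p.2.1 p.2.2}),
      ∃ y : {p : FormalMap n × (Fin l → FormalMap n) × FormalMap n //
        PartialLinearization μ F (2 ^ (k + 1)) s (ENNReal.ofReal (r (k + 1))) p.1 p.2.1 p.2.2},
        EqBelow (2 ^ k + 1) y.1.1 x.1.1 := by
    rintro k ⟨⟨Θ, G, Ψ⟩, hx⟩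
    have hpow : 2 ^ (k + 1) = 2 * 2 ^ k := by ring
    obtain ⟨Θ', G', Ψ', hy, hΘ⟩ := hx.step hμ Nat.one_le_two_pow hM
      (w := (omega μ (k + 1))⁻¹)
      (fun Q j hQ hQ' h0 => inv_smallDivisor_le μ hQ (by rw [hpow]; exact hQ') h0)
      (hw0 _) hM0 (t := ENNReal.ofReal (t k)) (e := ENNReal.ofReal (e k))
      (r' := ENNReal.ofReal (r (k + 1))) (by simpa using ht1 k)
      (by
        rw [← ENNReal.ofReal_one,
          ← ENNReal.ofReal_add one_pos.le (by have := hw0 (k + 1); positivity),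
          ← ENNReal.ofReal_pow (htn k), ← ENNReal.ofReal_mul (pow_nonneg (htn k) _),
          ← ENNReal.ofReal_mul (by have := hw0 (k + 1); positivity)]
        refine ENNReal.ofReal_le_ofReal (le_trans (le_of_eq ?_) (h1 k))
        ring)
      (by
        have := ENNReal.ofReal_le_ofReal (h2 k)
        rwa [ENNReal.ofReal_add (hrn _) (mul_nonneg (by norm_num) (hen k)),
          ENNReal.ofReal_mul (by norm_num : (0 : ℝ) ≤ 3), ENNReal.ofReal_mul (htn k),
          ENNReal.ofReal_ofNat] at this)
      (by
        have := ENNReal.ofReal_le_ofReal (h3 k)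
        rwa [ENNReal.ofReal_mul (by norm_num : (0 : ℝ) ≤ 3), ENNReal.ofReal_ofNat] at this)
    exact ⟨⟨(Θ', G', Ψ'), by rw [hpow]; exact hy⟩, hΘ⟩
  choose next hnext using hstep
  let x : ∀ k : ℕ, {p : FormalMap n × (Fin l → FormalMap n) × FormalMap n //
      PartialLinearization μ F (2 ^ k) s (ENNReal.ofReal (r k)) p.1 p.2.1 p.2.2} :=
    fun k => Nat.rec ⟨(Θ, G, Ψ), by rw [hr0]; exact S⟩ (fun k y => next k y) k
  have hx : ∀ k, EqBelow (k + 1) (x (k + 1)).1.1 (x k).1.1 := fun k =>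
    (hnext k (x k)).mono (Nat.succ_le_succ k.lt_two_pow_self.le)
  obtain ⟨T, hT⟩ := exists_limit (X := fun k => (x k).1.1) hx
  have hx2 : ∀ k, EqBelow 2 (x k).1.1 (ident n) := fun k => (x k).2.tangent
  have hT2 : EqBelow 2 T (ident n) := (hT 1).trans (hx2 1)
  have hx0 : ∀ k, (x k).1.1.NoConst := fun k =>
    ((hx2 k).mono (by norm_num : 0 + 1 ≤ 2)).noConst noConst_ident
  have hT0 : T.NoConst := (hT2.mono (by norm_num : 0 + 1 ≤ 2)).noConst noConst_ident
  refine ⟨T, r₀, hr₀, hT2, fun i => eq_of_eqBelow fun k => ?_, fun j => ?_⟩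
  · have hG := (x k).2.perturbation_order i
    have hG0 : ((x k).1.2.1 i).NoConst := hG.noConst noConst_ident
    have hDG : EqBelow (k + 1) ((diag (μ i)).comp ((x k).1.2.1 i)) (diag (μ i)) := by
      have := (EqBelow.refl (2 ^ k + 1) (diag (μ i))).comp hG (noConst_diag _) hG0 noConst_ident
      rw [comp_ident] at this
      exact this.mono (Nat.succ_le_succ k.lt_two_pow_self.le)
    have h4 : EqBelow (k + 1) ((F i).comp T) ((F i).comp (x k).1.1) :=
      (EqBelow.refl _ _).comp (hT k) (hF i) hT0 (hx0 k)
    rw [(x k).2.conj i] at h4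
    have h5 := (hT k).symm.comp hDG hT0 ((noConst_diag _).comp hG0) (noConst_diag _)
    exact (h4.trans h5).mono (by omega)
  · exact wnorm_le_of_approx fun d => ⟨(x d).1.1, (hT d).mono (by omega),
      (wnorm_mono (ENNReal.ofReal_le_ofReal (hr₀r d)) _).trans ((x d).2.bound j)⟩

/-! ### Sums of convergent power series -/

/-- The sum of a power series at a point (zero by convention where it does not converge). -/
noncomputable def evalSeries (f : MvPowerSeries (Fin n) ℂ) (x : Fin n → ℂ) : ℂ :=
  ∑' Q : Fin n →₀ ℕ, coeff Q f * ∏ k, x k ^ Q k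

theorem enorm_term_le (f : MvPowerSeries (Fin n) ℂ) (x : Fin n → ℂ) (Q : Fin n →₀ ℕ) :
    ‖coeff Q f * ∏ k, x k ^ Q k‖ₑ ≤ ‖coeff Q f‖ₑ * ‖x‖ₑ ^ Q.degree := by
  rw [enorm_mul]
  gcongr
  simp only [enorm_eq_nnnorm]
  rw [nnnorm_prod, Finsupp.degree_eq_sum]
  simp only [nnnorm_pow]
  rw [← Finset.prod_pow_eq_pow_sum]
  norm_cast
  refine Finset.prod_le_prod' fun k _ => ?_
  gcongr
  exact nnnorm_le_pi_nnnorm x k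

theorem summable_norm_of_tsum_enorm_ne_top {ι : Type*} {u : ι → ℂ} (h : ∑' i, ‖u i‖ₑ ≠ ∞) :
    Summable fun i => ‖u i‖ := by
  have := ENNReal.tsum_coe_ne_top_iff_summable.1 h
  exact NNReal.summable_coe.2 this

theorem tsum_enorm_ne_top_of_summable_norm {ι : Type*} {u : ι → ℂ}
    (h : Summable fun i => ‖u i‖) : ∑' i, ‖u i‖ₑ ≠ ∞ := by
  have h' : Summable fun i => ‖u i‖₊ := NNReal.summable_coe.1 h
  simpa only [enorm_eq_nnnorm] using ENNReal.tsum_coe_ne_top_iff_summable.2 h'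

theorem summable_norm_term {f : MvPowerSeries (Fin n) ℂ} {x : Fin n → ℂ}
    (h : wnorm ‖x‖ₑ f ≠ ∞) :
    Summable fun Q : Fin n →₀ ℕ => ‖coeff Q f * ∏ k, x k ^ Q k‖ :=
  summable_norm_of_tsum_enorm_ne_top
    (ne_top_of_le_ne_top h (ENNReal.tsum_le_tsum fun Q => enorm_term_le f x Q))

theorem hasSum_evalSeries {f : MvPowerSeries (Fin n) ℂ} {x : Fin n → ℂ}
    (h : wnorm ‖x‖ₑ f ≠ ∞) :
    HasSum (fun Q : Fin n →₀ ℕ => coeff Q f * ∏ k, x k ^ Q k) (evalSeries f x) :=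
  (summable_norm_term h).of_norm.hasSum

theorem enorm_tsum_le_tsum {ι : Type*} (u : ι → ℂ) : ‖∑' i, u i‖ₑ ≤ ∑' i, ‖u i‖ₑ := by
  by_cases h : ∑' i, ‖u i‖ₑ = ∞
  · rw [h]; exact le_top
  · have hs := summable_norm_of_tsum_enorm_ne_top h
    have h1 := nnnorm_tsum_le (f := u) (NNReal.summable_coe.1 hs)
    calc ‖∑' i, u i‖ₑ ≤ ((∑' i, ‖u i‖₊ : ℝ≥0) : ℝ≥0∞) := by exact_mod_cast h1
      _ = _ := ENNReal.coe_tsum (NNReal.summable_coe.1 hs)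

theorem enorm_evalSeries_le (f : MvPowerSeries (Fin n) ℂ) (x : Fin n → ℂ) :
    ‖evalSeries f x‖ₑ ≤ wnorm ‖x‖ₑ f :=
  (enorm_tsum_le_tsum _).trans (ENNReal.tsum_le_tsum fun Q => enorm_term_le f x Q)

theorem evalSeries_X (j : Fin n) (x : Fin n → ℂ) : evalSeries (X j) x = x j := by
  classical
  unfold evalSeries
  rw [tsum_eq_single (Finsupp.single j 1)]
  · rw [coeff_X, if_pos rfl, one_mul, Finset.prod_eq_single j]
    · simp
    · intro k _ hk
      simp [hk.symm]
    · simp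
  · intro Q hQ
    simp [coeff_X, hQ]

theorem evalSeries_one (x : Fin n → ℂ) : evalSeries (1 : MvPowerSeries (Fin n) ℂ) x = 1 := by
  classical
  unfold evalSeries
  rw [tsum_eq_single 0]
  · simp
  · intro Q hQ
    simp [coeff_one, hQ]

theorem evalSeries_smul (c : ℂ) (f : MvPowerSeries (Fin n) ℂ) (x : Fin n → ℂ) :
    evalSeries (c • f) x = c * evalSeries f x := by
  unfold evalSeries
  rw [← tsum_mul_left]
  exact tsum_congr fun Q => by simp [mul_assoc]

theorem evalSeries_sub {f g : MvPowerSeries (Fin n) ℂ} {x : Fin n → ℂ}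
    (hf : wnorm ‖x‖ₑ f ≠ ∞) (hg : wnorm ‖x‖ₑ g ≠ ∞) :
    evalSeries (f - g) x = evalSeries f x - evalSeries g x := by
  unfold evalSeries
  rw [← (summable_norm_term hf).of_norm.tsum_sub (summable_norm_term hg).of_norm]
  exact tsum_congr fun Q => by simp [sub_mul]

theorem evalSeries_mul {f g : MvPowerSeries (Fin n) ℂ} {x : Fin n → ℂ}
    (hf : wnorm ‖x‖ₑ f ≠ ∞) (hg : wnorm ‖x‖ₑ g ≠ ∞) :
    evalSeries (f * g) x = evalSeries f x * evalSeries g x := by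
  classical
  have key : ∀ a b : (Fin n →₀ ℕ) → ℂ, Summable (fun Q => ‖a Q‖) → Summable (fun Q => ‖b Q‖) →
      (∑' Q, a Q) * ∑' Q, b Q =
        ∑' Q, ∑ p ∈ Finset.HasAntidiagonal.antidiagonal Q, a p.1 * b p.2 := fun a b ha hb =>
    ha.of_norm.tsum_mul_tsum_eq_tsum_sum_antidiagonal hb.of_norm
      (summable_mul_of_summable_norm ha hb)
  unfold evalSeries
  rw [key _ _ (summable_norm_term hf) (summable_norm_term hg)]
  refine tsum_congr fun Q => ?_
  rw [coeff_mul, Finset.sum_mul]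
  refine Finset.sum_congr rfl fun p hp => ?_
  rw [← Finset.HasAntidiagonal.mem_antidiagonal.1 hp]
  simp only [Finsupp.add_apply, pow_add, Finset.prod_mul_distrib]
  ring

theorem evalSeries_pow {f : MvPowerSeries (Fin n) ℂ} {x : Fin n → ℂ}
    (hf : wnorm ‖x‖ₑ f ≠ ∞) (m : ℕ) : evalSeries (f ^ m) x = evalSeries f x ^ m := by
  induction m with
  | zero => simp [evalSeries_one]
  | succ m ih =>
    rw [pow_succ, pow_succ, evalSeries_mul _ hf, ih]
    exact ne_top_of_le_ne_top (ENNReal.pow_ne_top hf) (wnorm_pow_le le_rfl m)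

theorem evalSeries_monomial {a : FormalMap n} {x : Fin n → ℂ} {s : ℝ≥0∞} (hs : s ≠ ∞)
    (h : ∀ k, wnorm ‖x‖ₑ (a k) ≤ s) (Q : Fin n →₀ ℕ) :
    evalSeries (Q.prod fun k m => a k ^ m) x = ∏ k, evalSeries (a k) x ^ Q k := by
  induction Q using Finsupp.induction_linear with
  | zero => simp [evalSeries_one]
  | add P Q hP hQ =>
    rw [Finsupp.prod_add_index' (by simp) (by simp [pow_add]), evalSeries_mul, hP, hQ]
    · simp only [Finsupp.add_apply, pow_add, Finset.prod_mul_distrib]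
    · exact ne_top_of_le_ne_top (ENNReal.pow_ne_top hs) (wnorm_monomial_le h P)
    · exact ne_top_of_le_ne_top (ENNReal.pow_ne_top hs) (wnorm_monomial_le h Q)
  | single j m =>
    classical
    rw [Finsupp.prod_single_index (by simp), evalSeries_pow (ne_top_of_le_ne_top hs (h j)),
      Finset.prod_eq_single j]
    · simp
    · intro k _ hk
      simp [hk.symm]
    · simp

/-- The sum of a composition is the composition of the sums, on polydiscs where both series
converge absolutely. -/
theorem evalSeries_comp {f a : FormalMap n} (ha : a.NoConst) {x : Fin n → ℂ} {s : ℝ≥0∞}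
    (hs : s ≠ ∞) (h : ∀ k, wnorm ‖x‖ₑ (a k) ≤ s) {j : Fin n} (hf : wnorm s (f j) ≠ ∞) :
    evalSeries (f.comp a j) x = evalSeries (f j) fun k => evalSeries (a k) x := by
  set u : (Fin n →₀ ℕ) → (Fin n →₀ ℕ) → ℂ := fun P Q =>
    coeff Q (f j) * (coeff P (Q.prod fun k m => a k ^ m) * ∏ k, x k ^ P k) with hu
  have hmon : ∀ Q : Fin n →₀ ℕ, wnorm ‖x‖ₑ (Q.prod fun k m => a k ^ m) ≤ s ^ Q.degree :=
    fun Q => wnorm_monomial_le h Q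
  have hsum : Summable (Function.uncurry u) := by
    refine Summable.of_norm (summable_norm_of_tsum_enorm_ne_top ?_)
    refine ne_top_of_le_ne_top hf ?_
    rw [ENNReal.tsum_prod', ENNReal.tsum_comm]
    refine ENNReal.tsum_le_tsum fun Q => ?_
    simp only [Function.uncurry, hu, enorm_mul (coeff Q (f j))]
    rw [ENNReal.tsum_mul_left]
    gcongr
    exact (ENNReal.tsum_le_tsum fun P => enorm_term_le _ x P).trans (hmon Q)
  calc evalSeries (f.comp a j) x = ∑' P, ∑' Q, u P Q := by
        unfold evalSeries
        refine tsum_congr fun P => ?_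
        simp only [FormalMap.comp]
        rw [coeff_subst ha.hasSubst,
          ← tsum_eq_finsum (L := .unconditional _) (coeff_subst_finite ha.hasSubst _ _),
          ← tsum_mul_right]
        exact tsum_congr fun Q => by rw [smul_eq_mul, mul_assoc]
    _ = ∑' Q, ∑' P, u P Q := hsum.tsum_comm.symm
    _ = _ := by
        unfold evalSeries
        refine tsum_congr fun Q => ?_
        simp only [hu]
        rw [tsum_mul_left]
        congr 1
        exact evalSeries_monomial hs h Q

/-! ### Analyticity of the sum -/

theorem exists_list_monomial (Q : Fin n →₀ ℕ) :
    ∃ L : List (Fin n), L.length = Q.degree ∧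
      ∀ x : Fin n → ℂ, (L.map x).prod = ∏ k, x k ^ Q k := by
  induction Q using Finsupp.induction_linear with
  | zero => exact ⟨[], by simp, by simp⟩
  | add P Q hP hQ =>
    obtain ⟨L, hL, hL'⟩ := hP
    obtain ⟨L₁, hL₁, hL₁'⟩ := hQ
    refine ⟨L ++ L₁, by simp [hL, hL₁], fun x => ?_⟩
    simp [hL', hL₁', pow_add, Finset.prod_mul_distrib]
  | single j m =>
    classical
    refine ⟨List.replicate m j, by simp, fun x => ?_⟩
    rw [List.map_replicate, List.prod_replicate, Finset.prod_eq_single j]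
    · simp
    · intro k _ hk
      simp [hk.symm]
    · simp

/-- The monomial `x^Q` is the restriction to the diagonal of a multilinear form of norm `≤ 1`. -/
theorem exists_multilinear_monomial (m : ℕ) (Q : Fin n →₀ ℕ) :
    ∃ T : ContinuousMultilinearMap ℂ (fun _ : Fin m => (Fin n → ℂ)) ℂ,
      ‖T‖ ≤ 1 ∧ (Q.degree = m → ∀ x : Fin n → ℂ, (T fun _ => x) = ∏ k, x k ^ Q k) := by
  by_cases hQ : Q.degree = m
  swap
  · exact ⟨0, by simp, fun h => absurd h hQ⟩
  obtain ⟨L, hL, hLx⟩ := exists_list_monomial Q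
  obtain rfl : L.length = m := hL.trans hQ
  refine ⟨(ContinuousMultilinearMap.mkPiAlgebra ℂ (Fin L.length) ℂ).compContinuousLinearMap
    fun i => ContinuousLinearMap.proj (R := ℂ) (φ := fun _ : Fin n => ℂ) (L.get i), ?_,
    fun _ x => ?_⟩
  · refine (ContinuousMultilinearMap.norm_compContinuousLinearMap_le _ _).trans ?_
    rw [ContinuousMultilinearMap.norm_mkPiAlgebra, one_mul]
    refine Finset.prod_le_one (fun _ _ => norm_nonneg _) fun i _ => ?_
    refine ContinuousLinearMap.opNorm_le_bound _ zero_le_one fun x => ?_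
    rw [one_mul]
    exact norm_le_pi_norm x _
  · rw [← hLx x]
    simp [← List.prod_ofFn]

theorem analyticAt_evalSeries {f : MvPowerSeries (Fin n) ℂ} {r : ℝ≥0} (hr : 0 < r)
    (hf : wnorm r f ≠ ∞) : AnalyticAt ℂ (evalSeries f) 0 := by
  choose T hT1 hT using fun (m : ℕ) (Q : Fin n →₀ ℕ) => exists_multilinear_monomial m Q
  set A : ℕ → Finset (Fin n →₀ ℕ) := fun m => (Finsupp.finite_of_degree_eq m).toFinset with hA
  have hmem : ∀ m Q, Q ∈ A m ↔ Q.degree = m := by simp [hA]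
  set p : FormalMultilinearSeries ℂ (Fin n → ℂ) ℂ := fun m => ∑ Q ∈ A m, coeff Q f • T m Q
    with hp
  have hball : HasFPowerSeriesOnBall (evalSeries f) p 0 r := by
    refine ⟨?_, by exact_mod_cast hr, fun {y} hy => ?_⟩
    · refine p.le_radius_of_bound (wnorm r f).toReal fun m => ?_
      have h1 : ‖p m‖ₑ * r ^ m ≤ wnorm r f := by
        calc ‖p m‖ₑ * (r : ℝ≥0∞) ^ m ≤ (∑ Q ∈ A m, ‖coeff Q f‖ₑ) * (r : ℝ≥0∞) ^ m := by
              gcongr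
              refine (enorm_sum_le (A m) fun Q => coeff Q f • T m Q).trans
                (Finset.sum_le_sum fun Q _ => ?_)
              rw [enorm_smul]
              refine (mul_le_mul_right (?_ : ‖T m Q‖ₑ ≤ 1) _).trans (mul_one _).le
              rw [← ofReal_norm, ← ENNReal.ofReal_one]
              exact ENNReal.ofReal_le_ofReal (hT1 m Q)
          _ = ∑ Q ∈ A m, ‖coeff Q f‖ₑ * (r : ℝ≥0∞) ^ Q.degree := by
              rw [Finset.sum_mul]
              exact Finset.sum_congr rfl fun Q hQ => by rw [(hmem m Q).1 hQ]
          _ ≤ wnorm r f := ENNReal.sum_le_tsum _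
      have h2 := ENNReal.toReal_mono hf h1
      simpa using h2
    · have hy' : wnorm ‖y‖ₑ f ≠ ∞ := by
        refine ne_top_of_le_ne_top hf (wnorm_mono ?_ f)
        rw [Metric.mem_eball, edist_zero_right] at hy
        exact hy.le
      have h1 := (Equiv.sigmaFiberEquiv (Finsupp.degree : (Fin n →₀ ℕ) → ℕ)).hasSum_iff.2
        (hasSum_evalSeries hy')
      rw [zero_add]
      refine h1.sigma fun m => ?_
      have h2 : (p m fun _ => y) = ∑ Q ∈ A m, coeff Q f * ∏ k, y k ^ Q k := by
        simp only [hp, _root_.sum_apply, _root_.smul_apply,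
          smul_eq_mul]
        exact Finset.sum_congr rfl fun Q hQ => by rw [hT m Q ((hmem m Q).1 hQ)]
      have h3 := (A m).hasSum fun Q : Fin n →₀ ℕ => coeff Q f * ∏ k, y k ^ Q k
      rw [h2]
      refine (Equiv.hasSum_iff (Equiv.subtypeEquivRight (hmem m))).1 ?_
      exact h3
  exact hball.analyticAt

/-- The sum of a power series without terms of degree `< 2` has vanishing derivative. -/
theorem hasFDerivAt_evalSeries_zero {f : MvPowerSeries (Fin n) ℂ} {r : ℝ≥0} (hr : 0 < r)
    (hf : wnorm r f ≠ ∞) (h2 : ∀ Q : Fin n →₀ ℕ, Q.degree < 2 → coeff Q f = 0) :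
    HasFDerivAt (evalSeries f) (0 : (Fin n → ℂ) →L[ℂ] ℂ) 0 := by
  refine Asymptotics.IsBigO.hasFDerivAt (n := 2) ?_ one_lt_two
  refine Asymptotics.IsBigO.of_bound ((wnorm r f).toReal / r ^ 2) ?_
  filter_upwards [Metric.ball_mem_nhds (0 : Fin n → ℂ) (NNReal.coe_pos.2 hr)] with x hx
  rw [mem_ball_zero_iff] at hx
  have hxr : ‖x‖ₑ = (‖x‖₊ / r : ℝ≥0) * (r : ℝ≥0∞) := by
    rw [← ENNReal.coe_mul, div_mul_cancel₀ _ hr.ne']; rfl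
  have h1 : ((‖x‖₊ / r : ℝ≥0) : ℝ≥0∞) ≤ 1 := by
    norm_cast
    exact div_le_one_of_le₀ hx.le zero_le
  have h3 := (enorm_evalSeries_le f x).trans
    (hxr ▸ wnorm_mul_radius_le (d := 2) h1 h2)
  have h4 := ENNReal.toReal_mono (ENNReal.mul_ne_top (by simp) hf) h3
  rw [ENNReal.toReal_mul] at h4
  have h5 : ‖evalSeries f x‖ ≤ (‖x‖ / r) ^ 2 * (wnorm r f).toReal := by simpa using h4
  refine h5.trans (le_of_eq ?_)
  rw [sub_zero, norm_pow, norm_norm]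
  ring

/-! ### From germs to formal maps and back -/

theorem IsTaylorExpansion.exists_wnorm_ne_top {f : FormalMap n} {F : (Fin n → ℂ) → (Fin n → ℂ)}
    (h : IsTaylorExpansion f F) :
    ∃ δ : ℝ≥0, 0 < δ ∧ ∀ t : ℝ≥0, t ≤ δ → ∀ j, wnorm t (f j) ≠ ∞ := by
  obtain ⟨ε, hε, hball⟩ := Metric.eventually_nhds_iff.1 h
  lift ε to ℝ≥0 using hε.le
  have hδ : 0 < ε / 2 := half_pos (by exact_mod_cast hε)
  refine ⟨ε / 2, hδ, fun t ht j => ?_⟩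
  set δ : ℝ≥0 := ε / 2 with hδε
  have hnorm : ‖((δ : ℝ) : ℂ)‖ = δ := by
    rw [Complex.norm_real, Real.norm_of_nonneg δ.coe_nonneg]
  -- absolute convergence at the diagonal point `(δ, …, δ)` bounds the norm
  have hx : dist (fun _ : Fin n => ((δ : ℝ) : ℂ)) 0 < ε := by
    rw [dist_zero_right]
    refine (pi_norm_const_le _).trans_lt ?_
    rw [hnorm, hδε]
    exact_mod_cast half_lt_self (by exact_mod_cast hε)
  have hs := (hball hx j).summable.norm
  have hs' := tsum_enorm_ne_top_of_summable_norm hs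
  refine ne_top_of_le_ne_top hs' ((wnorm_mono (ENNReal.coe_le_coe.2 ht) _).trans ?_)
  refine ENNReal.tsum_le_tsum fun Q => ?_
  have hterm : ‖coeff Q (f j) * ∏ k, ((δ : ℝ) : ℂ) ^ Q k‖ₑ =
      ‖coeff Q (f j)‖ₑ * (δ : ℝ≥0∞) ^ Q.degree := by
    have h1 : ‖((δ : ℝ) : ℂ)‖ₑ = δ := ENNReal.coe_inj.2 (NNReal.eq hnorm)
    rw [enorm_mul, Finset.prod_pow_eq_pow_sum, ← Finsupp.degree_eq_sum, enorm_pow, h1]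
  exact hterm.symm.le

theorem IsTaylorExpansion.eventually_eq {f : FormalMap n} {F : (Fin n → ℂ) → (Fin n → ℂ)}
    (h : IsTaylorExpansion f F) :
    ∀ᶠ x in 𝓝 (0 : Fin n → ℂ), F x = fun j => evalSeries (f j) x := by
  filter_upwards [h] with x hx
  funext j
  exact (hx j).tsum_eq.symm

theorem evalSeries_at_zero (f : MvPowerSeries (Fin n) ℂ) :
    evalSeries f 0 = constantCoeff f := by
  unfold evalSeries
  rw [tsum_eq_single 0]
  · simp
  · intro Q hQ
    obtain ⟨k, hk⟩ := Finsupp.ne_iff.1 hQ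
    rw [Finset.prod_eq_zero (Finset.mem_univ k), mul_zero]
    simpa using hk

theorem IsTaylorExpansion.noConst {f : FormalMap n} {F : (Fin n → ℂ) → (Fin n → ℂ)}
    (h : IsTaylorExpansion f F) (h0 : F 0 = 0) : f.NoConst := fun j => by
  rw [← evalSeries_at_zero]
  have := congr_fun h.eventually_eq.self_of_nhds j
  rw [h0] at this
  exact this.symm

/-- A convergent formal map tangent to the identity is the Taylor expansion of a germ of
holomorphic diffeomorphism tangent to the identity. -/
theorem exists_germ_inverse {Θ : FormalMap n} (hΘ : EqBelow 2 Θ (ident n)) {r : ℝ≥0}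
    (hr : 0 < r) (hb : ∀ j, wnorm r (Θ j) ≠ ∞) :
    ∃ Φ : (Fin n → ℂ) → (Fin n → ℂ), AreInverseGerms Φ (fun x j => evalSeries (Θ j) x) ∧
      HasFDerivAt Φ (ContinuousLinearMap.id ℂ (Fin n → ℂ)) 0 := by
  set θ : (Fin n → ℂ) → (Fin n → ℂ) := fun x j => evalSeries (Θ j) x with hθ
  have hθa : AnalyticAt ℂ θ 0 := AnalyticAt.pi fun j => analyticAt_evalSeries hr (hb j)
  have hΘ0 : Θ.NoConst := (hΘ.mono (by norm_num : 0 + 1 ≤ 2)).noConst noConst_ident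
  have hθ0 : θ 0 = 0 := by
    funext j
    exact (evalSeries_at_zero _).trans (hΘ0 j)
  have hdj : ∀ j, HasFDerivAt (fun x => evalSeries (Θ j) x)
      (ContinuousLinearMap.proj (R := ℂ) (φ := fun _ : Fin n => ℂ) j) 0 := by
    intro j
    have hX : wnorm r (X j : MvPowerSeries (Fin n) ℂ) ≠ ∞ := by rw [wnorm_X]; simp
    have h1 := hasFDerivAt_evalSeries_zero (f := Θ j - X j) hr
      (ne_top_of_le_ne_top (ENNReal.add_ne_top.2 ⟨hb j, hX⟩) (wnorm_sub_le _ _ _))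
      (fun Q hQ => by
        have := hΘ j Q hQ
        simp [ident] at this
        simp [this])
    have h2 := h1.add (ContinuousLinearMap.proj (R := ℂ) (φ := fun _ : Fin n => ℂ) j).hasFDerivAt
    rw [zero_add] at h2
    refine h2.congr_of_eventuallyEq ?_
    filter_upwards [Metric.ball_mem_nhds (0 : Fin n → ℂ) (NNReal.coe_pos.2 hr)] with x hx
    rw [mem_ball_zero_iff] at hx
    have hxr : ‖x‖ₑ ≤ r := ENNReal.coe_le_coe.2 hx.le
    rw [Pi.add_apply, evalSeries_sub (ne_top_of_le_ne_top (hb j) (wnorm_mono hxr _))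
      (ne_top_of_le_ne_top hX (wnorm_mono hxr _)), evalSeries_X]
    simp
  have hd : HasFDerivAt θ (ContinuousLinearMap.id ℂ (Fin n → ℂ)) 0 := hasFDerivAt_pi'.2 hdj
  have hsd : HasStrictFDerivAt θ
      ((ContinuousLinearEquiv.refl ℂ (Fin n → ℂ) : (Fin n → ℂ) →L[ℂ] (Fin n → ℂ))) 0 := by
    have := hθa.hasStrictFDerivAt
    rwa [hd.fderiv] at this
  obtain ⟨p, hp⟩ := hθa
  have hp1 : p 1 = (continuousMultilinearCurryFin1 ℂ (Fin n → ℂ) (Fin n → ℂ)).symm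
      (ContinuousLinearEquiv.refl ℂ (Fin n → ℂ) : (Fin n → ℂ) →L[ℂ] (Fin n → ℂ)) := by
    rw [LinearIsometryEquiv.eq_symm_apply]
    exact hp.hasFDerivAt.unique hd
  have hinv := ((hsd.toOpenPartialHomeomorph θ).hasFPowerSeriesAt_symm
    hsd.mem_toOpenPartialHomeomorph_source hp hp1).analyticAt
  refine ⟨hsd.localInverse θ _ 0, ⟨?_, ⟨p, hp⟩, ?_, hθ0, ?_, ?_⟩, ?_⟩
  · have := hinv
    rw [hsd.toOpenPartialHomeomorph_coe, hθ0] at this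
    exact this
  · have := hsd.localInverse_apply_image
    rwa [hθ0] at this
  · exact hsd.eventually_left_inverse
  · have := hsd.eventually_right_inverse
    rw [hθ0] at this
    exact this
  · have := hsd.to_localInverse.hasFDerivAt
    rw [hθ0] at this
    exact this

/-- A family which is formally linearizable by a diffeomorphism tangent to the identity has a
formal linearization `Ψ` tangent to the identity in the form `F i ∘ Ψ = Ψ ∘ D i`, and the linear
part of `F i` is `D i`. -/
theorem formal_linearization_data {μ : Fin l → Fin n → ℂ} {F : Fin l → FormalMap n}
    (hF : ∀ i, (F i).NoConst) {Φ Ψ : FormalMap n} (hinv : FormalMap.AreInverse Φ Ψ)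
    (htan : Φ.TangentToId) (h : ∀ i, Φ.comp ((F i).comp Ψ) = diag (μ i)) :
    EqBelow 2 Ψ (ident n) ∧ (∀ i, (F i).comp Ψ = Ψ.comp (diag (μ i))) ∧
      ∀ i, EqBelow 2 (F i) (diag (μ i)) := by
  have hΦ0 : Φ.NoConst := hinv.constantCoeff_left
  have hΨ0 : Ψ.NoConst := hinv.constantCoeff_right
  have hΦ2 : EqBelow 2 Φ (ident n) := by
    classical
    intro j Q hQ
    rcases Nat.lt_succ_iff_lt_or_eq.1 hQ with hQ | hQ
    · have : Q = 0 := by rw [← Finsupp.degree_eq_zero_iff]; omega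
      subst this
      simpa [ident] using hΦ0 j
    · obtain ⟨k, rfl⟩ := (Finsupp.sum_eq_one_iff Q).1 hQ
      rw [htan j k]
      simp [ident, coeff_X, Finsupp.single_left_inj, eq_comm]
  have hΨ2 : EqBelow 2 Ψ (ident n) := by
    have := hΦ2.comp_left hΨ0
    rw [hinv.comp_eq_left, ident_comp hΨ0] at this
    exact this.symm
  have hlin : ∀ i, (F i).comp Ψ = Ψ.comp (diag (μ i)) := by
    intro i
    rw [← h i, ← comp_assoc _ hΦ0 ((hF i).comp hΨ0), hinv.comp_eq_right,
      ident_comp ((hF i).comp hΨ0)]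
  refine ⟨hΨ2, hlin, fun i => ?_⟩
  have h1 := hΨ2.comp_right hΨ0 noConst_ident (noConst_iff.1 (hF i))
  have h2 := hΨ2.comp_left (noConst_diag (μ i))
  rw [ident_comp (noConst_diag _), ← hlin i] at h2
  rw [comp_ident] at h1
  exact h1.symm.trans h2

/-- A convergent series of order `≥ 2` is small compared with the radius on small polydiscs. -/
theorem exists_radius_wnorm_le {t : ℝ≥0} (ht : 0 < t) {ι : Type*} [Fintype ι]
    {g : ι → MvPowerSeries (Fin n) ℂ} (hg : ∀ i, wnorm t (g i) ≠ ∞)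
    (h2 : ∀ i, ∀ Q : Fin n →₀ ℕ, Q.degree < 2 → coeff Q (g i) = 0) :
    ∃ R : ℝ≥0, 0 < R ∧ R ≤ t ∧ ∀ i, wnorm R (g i) ≤ R := by
  have hsum : ∑ i, wnorm t (g i) ≠ ∞ := ENNReal.sum_ne_top.2 fun i _ => hg i
  set N : ℝ≥0 := (∑ i, wnorm t (g i)).toNNReal with hN
  have hNi : ∀ i, wnorm t (g i) ≤ N := fun i => by
    rw [hN, ENNReal.coe_toNNReal hsum]
    exact Finset.single_le_sum (f := fun i => wnorm t (g i)) (fun _ _ => zero_le)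
      (Finset.mem_univ i)
  set c : ℝ≥0 := t / (N + t) with hc
  have hNt : 0 < N + t := add_pos_of_nonneg_of_pos zero_le ht
  have hc1 : c ≤ 1 := div_le_one_of_le₀ le_add_self zero_le
  have hcN : c * N ≤ t := by
    rw [hc, div_mul_eq_mul_div, div_le_iff₀ hNt]
    gcongr
    exact le_self_add
  refine ⟨c * t, mul_pos (div_pos ht hNt) ht, mul_le_of_le_one_left zero_le hc1, fun i => ?_⟩
  rw [ENNReal.coe_mul]
  refine (wnorm_mul_radius_le (by exact_mod_cast hc1) (h2 i)).trans
    ((mul_le_mul_right (hNi i) _).trans ?_)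
  have : c ^ 2 * N ≤ c * t := by
    rw [pow_two, mul_assoc]
    gcongr
  exact_mod_cast this

end GermLin

open GermLin GermLin.FormalMap in
theorem mainTheorem2 (n l : ℕ) (μ : Fin l → Fin n → ℂ) (hμ : ∀ i j, μ i j ≠ 0)
    (F : Fin l → (Fin n → ℂ) → (Fin n → ℂ))
    (hF : GermLin.IsAbelianFamily μ F)
    (hD : GermLin.IsDiophantine μ)
    (hformal : GermLin.FormallyLinearizable μ F) :
    GermLin.HolomorphicallyLinearizable μ F := by
  obtain ⟨f, hf, Φ, Ψ, hinv, htan, hΦ⟩ := hformal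
  have hf0 : ∀ i, (f i).NoConst := fun i => by
    obtain ⟨g, hg⟩ := hF.diffeo i
    exact (hf i).noConst hg.map_zero_left
  obtain ⟨hΨ2, hlin, hf2⟩ := formal_linearization_data hf0 hinv htan hΦ
  have hΨ0 : Ψ.NoConst := hinv.constantCoeff_right
  have hD0 : ∀ i, (diag (μ i)).NoConst := fun i => noConst_diag _
  -- a common polydisc of convergence
  obtain ⟨t, ht, htf⟩ : ∃ t : NNReal, 0 < t ∧ ∀ i j, wnorm t (f i j) ≠ ⊤ := by
    choose δ hδ hδf using fun i => (hf i).exists_wnorm_ne_top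
    rcases isEmpty_or_nonempty (Fin l) with hl | hl
    · exact ⟨1, one_pos, fun i => hl.elim i⟩
    · obtain ⟨i₀, hi₀⟩ := Finite.exists_min δ
      exact ⟨δ i₀, hδ i₀, fun i j => hδf i _ (hi₀ i) j⟩
  set G : Fin l → FormalMap n := fun i => (diag (μ i)⁻¹).comp (f i) with hG
  have hG0 : ∀ i, (G i).NoConst := fun i => (noConst_diag _).comp (hf0 i)
  have hDG : ∀ i, (diag (μ i)).comp (G i) = f i := fun i => by
    simp only [hG]
    rw [← comp_assoc _ (noConst_diag _) (hf0 i), diag_comp_diag_inv (hμ i), ident_comp (hf0 i)]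
  have hG2 : ∀ i, EqBelow 2 (G i) (ident n) := fun i => by
    have := (EqBelow.refl 2 (diag (μ i)⁻¹)).comp (hf2 i) (noConst_diag _) (hf0 i) (hD0 i)
    rwa [diag_inv_comp_diag (hμ i)] at this
  obtain ⟨R, hR, hRt, hRG⟩ := exists_radius_wnorm_le ht
    (g := fun p : Fin l × Fin n => (G p.1 - ident n) p.2)
    (fun p => by
      refine ne_top_of_le_ne_top ?_ (wnorm_sub_le _ _ _)
      simp only [hG]
      rw [diag_comp _ (hf0 p.1), wnorm_smul, ident, wnorm_X]
      exact ENNReal.add_ne_top.2 ⟨ENNReal.mul_ne_top (by simp) (htf _ _), by simp⟩)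
    (fun p Q hQ => by
      rw [Pi.sub_apply, map_sub, hG2 p.1 p.2 Q hQ, sub_self])
  have hofR : ENNReal.ofReal (R : ℝ) = R := ENNReal.ofReal_coe_nnreal
  obtain ⟨Θ, r₀, hr₀, hΘ2, hΘ, hΘb⟩ := exists_bounded_linearization hμ hD hf0
    (s := R) (R := R) (Θ := ident n) (G := G) (Ψ := Ψ) hR
    { tangent := EqBelow.refl _ _
      perturbation_order := hG2
      linearizer_order := hΨ2
      conj := fun i => by
        rw [comp_ident, ident_comp ((hD0 i).comp (hG0 i)), hDG]
      linearizes := fun i => by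
        rw [← comp_assoc _ (hG0 i) hΨ0, hDG, hlin i]
      bound := fun j => by
        rw [hofR]; exact (wnorm_X _ j).le
      perturbation_bound := fun i j => by
        rw [hofR]; exact hRG (i, j) }
  lift r₀ to NNReal using hr₀.le
  rw [ENNReal.ofReal_coe_nnreal] at hΘb
  have hr₀' : 0 < r₀ := by exact_mod_cast hr₀
  obtain ⟨φ, hφ, hφ'⟩ := exists_germ_inverse hΘ2 hr₀'
    fun j => ne_top_of_le_ne_top ENNReal.coe_ne_top (hΘb j)
  refine ⟨φ, _, hφ, hφ', fun i => ?_⟩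
  have hΘ0 : Θ.NoConst := (hΘ2.mono (by norm_num : 0 + 1 ≤ 2)).noConst noConst_ident
  set θ : (Fin n → ℂ) → (Fin n → ℂ) := fun x j => evalSeries (Θ j) x with hθ
  have hθt : Filter.Tendsto θ (nhds 0) (nhds 0) := by
    have := hφ.analytic_right.continuousAt
    rwa [ContinuousAt, hφ.map_zero_right] at this
  have hDt : Filter.Tendsto (diagMap (μ i)) (nhds 0) (nhds 0) := by
    have := (diagMap (μ i)).continuous.tendsto 0
    rwa [map_zero] at this
  have hsmall : ∀ᶠ x in nhds (0 : Fin n → ℂ), ‖x‖ < r₀ := by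
    filter_upwards [Metric.ball_mem_nhds (0 : Fin n → ℂ) hr₀] with x hx
    rwa [mem_ball_zero_iff] at hx
  have hsmall' : ∀ᶠ x in nhds (0 : Fin n → ℂ), ∀ k, ‖μ i k‖ₑ * ‖x‖ₑ ≤ r₀ := by
    refine Filter.eventually_all.2 fun k => ?_
    have : Filter.Tendsto (fun x : Fin n → ℂ => ‖μ i k‖ * ‖x‖) (nhds 0) (nhds 0) := by
      have h1 : Continuous fun x : Fin n → ℂ => ‖μ i k‖ * ‖x‖ := by fun_prop
      simpa using h1.tendsto 0
    filter_upwards [this.eventually_lt_const hr₀] with x hx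
    rw [← ofReal_norm, ← ofReal_norm, ← ENNReal.ofReal_mul (norm_nonneg _),
      ← ENNReal.ofReal_coe_nnreal]
    exact ENNReal.ofReal_le_ofReal hx.le
  filter_upwards [hθt.eventually (hf i).eventually_eq, hDt.eventually hφ.comp_eq_left,
    hsmall, hsmall'] with x hx1 hx2 hx3 hx4
  have hxr : ‖x‖ₑ ≤ (r₀ : ENNReal) := ENNReal.coe_le_coe.2 hx3.le
  have key : F i (θ x) = θ (diagMap (μ i) x) := by
    rw [hx1]
    funext j
    have h1 := evalSeries_comp (f := f i) hΘ0 (x := x) (s := R) ENNReal.coe_ne_top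
      (fun k => (wnorm_mono hxr _).trans (hΘb k)) (j := j)
      (ne_top_of_le_ne_top (htf i j) (wnorm_mono (ENNReal.coe_le_coe.2 hRt) _))
    have h2 := evalSeries_comp (f := Θ) (hD0 i) (x := x) (s := r₀) ENNReal.coe_ne_top
      (fun k => by rw [diag, wnorm_smul, wnorm_X]; exact hx4 k) (j := j)
      (ne_top_of_le_ne_top ENNReal.coe_ne_top (hΘb j))
    rw [← hΘ i, h1] at h2
    refine h2.trans ?_
    simp only [diag, evalSeries_smul, evalSeries_X]
    rfl
  have hx2' : φ (θ (diagMap (μ i) x)) = diagMap (μ i) x := hx2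
  simp only [Function.comp_apply]
  exact (congr_arg φ key).trans hx2'
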